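/- Let $k\ge 4$, let $H=(H_1,\dots,H_k)\in[\tfrac12,1)^k$ satisfy $\sum_{i=1}^k H_i>k-2$, and let $D\subset\mathbb R^k$ be a bounded domain with $C^\infty$ boundary. Let $$G^k(x,y)=\frac{1}{k(2-k)\omega_k}\,|x-y|^{2-k},\qquad G_D^k(x,y)=G^k(x,y)-\mathbb E_x\big(G^k(B_\tau,y)\big),\quad x,y\in D,$$ where $\omega_k$ is the volume of the unit ball of $\mathbb R^k$ and $B_\tau$ is the position at its first exit from $D$ of a $k$-dimensional Brownian motion started at $x$. Functions on $D$ are extended by $0$ to $\mathbb R^k$, and $$\|h\|_{L^{p_1,\dots,p_k}(D)}=\Big(\int_{\mathbb R}\Big(\cdots\Big(\int_{\mathbb R}|1_D(\eta)h(\eta)|^{p_1}d\eta_1\Big)^{p_2/p_1}\cdots\Big)^{p_k/p_{k-1}}d\eta_k\Big)^{1/p_k}.$$ (i) There is a constant $K>0$, depending only on $H$, $D$ and $k$, such that, for every $x\in D$, $G_D^k(x,\cdot)$ is measurable, and $$\sup_{x\in D}\|G_D^k(x,\cdot)\|_{L^{1/H_1,\dots,1/H_k}(D)}\le K .$$ (ii)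 Consequently the stochastic convolution $\int_D G_D^k(x,y)\,dB^H(y)$ is well defined, in the following sense. Let $B^H$ be a fractional Brownian field on $\mathbb R^k$, i.e. a centred Gaussian process with covariance $\mathbb E(B^H(x)B^H(y))=\prod_{i=1}^k\frac12\big(|x_i|^{2H_i}+|y_i|^{2H_i}-|x_i-y_i|^{2H_i}\big)$. For an elementary function (finite linear combination of indicators of rectangles) $\varphi=\sum_l\varphi_l 1_{[a^l,b^l]}$ put $\mathcal I(\varphi)=\sum_l\varphi_l B^H([a^l,b^l])$, where $B^H([a,b])$ is the rectangular increment. Let $|\mathcal H^H|$ be the set of measurable $\varphi:\mathbb R^k\to\mathbb R$ with $$\int_{\mathbb R^k}du\int\prod_{i:H_i>1/2}H_i(2H_i-1)|u_i-v_i|^{2H_i-2}dv_i\;|\varphi(u)|\,|\varphi(w)|<\infty,$$ where $w_i=v_i$ if $H_i>\frac12$ and $w_i=u_i$ if $H_i=\frac12$, and let $\|\varphi\|_{\mathcal H^H}^2$ be the same integral with $\varphi(u)\varphi(w)$ in place of $|\varphi(u)||\varphi(w)|$. Then for every $x\in D$ the function $1_DG_D^k(x,\cdot)$ belongs to $|\mathcal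 H^H|$, and there is a random variable $J(x)\in L^2(\Omega)$, unique up to almost sure equality, that is the $L^2(\Omega)$-limit of $\mathcal I(\varphi_n)$ for some elementary functions $\varphi_n$ with $\|\varphi_n-1_DG_D^k(x,\cdot)\|_{\mathcal H^H}\to0$ (and the limit is the same, almost surely, for any such sequence along which $\mathcal I(\varphi_n)$ converges in $L^2(\Omega)$). Moreover $\sup_{x\in D}\mathbb E\,|J(x)|^2\le K'$ for a constant $K'>0$ depending only on $H$, $D$ and $k$. -/

import Mathlib

open MeasureTheory ProbabilityTheory Filter Topology Set
open scoped ENNReal NNReal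

namespace FracPoisson

/-- The Euclidean space `ℝ^k`, with coordinates `x i`, `i : Fin k`. -/
abbrev Space (k : ℕ) : Type := EuclideanSpace ℝ (Fin k)

/-! ### Domains, Brownian motion and the Green function -/

/-- A bounded domain (nonempty connected open set) with `C^∞` boundary: near each boundary point
`D` is the negativity set of a smooth function whose differential does not vanish at that point. -/
structure IsBoundedSmoothDomain {k : ℕ} (D : Set (Space k)) : Prop where
  isOpen : IsOpen D
  isConnected : IsConnected D
  isBounded : Bornology.IsBounded D
  smooth_boundary : ∀ z ∈ frontier D, ∃ (U : Set (Space k)) (ρ : Space k → ℝ),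
    IsOpen U ∧ z ∈ U ∧ ContDiffOn ℝ ((⊤ : ℕ∞) : WithTop ℕ∞) ρ U ∧ fderiv ℝ ρ z ≠ 0 ∧ ∀ y ∈ U, (y ∈ D ↔ ρ y < 0)

/-- A standard `k`-dimensional Brownian motion (started at `0`): its components are independent
real Brownian motions. -/
structure IsBrownianMotion {k : ℕ} {Ω : Type*} [MeasurableSpace Ω]
    (W : ℝ≥0 → Ω → Space k) (P : Measure Ω) : Prop where
  isBrownianReal : ∀ i : Fin k, IsBrownianReal (fun t ω => W t ω i) P
  independent : iIndepFun (fun (i : Fin k) (ω : Ω) (t : ℝ≥0) => W t ω i) P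

/-- The first exit time from `D` of the path `t ↦ x + W t ω`
(with value `0` if the path never leaves `D`, an event of probability zero for bounded `D`). -/
noncomputable def exitTime {k : ℕ} {Ω : Type*} (D : Set (Space k)) (W : ℝ≥0 → Ω → Space k)
    (x : Space k) (ω : Ω) : ℝ≥0 :=
  sInf {t : ℝ≥0 | x + W t ω ∉ D}

/-- The position `B_τ` at the first exit from `D` of the Brownian motion started at `x`. -/
noncomputable def exitPoint {k : ℕ} {Ω : Type*} (D : Set (Space k)) (W : ℝ≥0 → Ω → Space k)
    (x : Space k) (ω : Ω) : Space k :=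
  x + W (exitTime D W x ω) ω

/-- The fundamental solution `G^k(x,y)` of the Laplacian on `ℝ^k`, `k ≥ 2`:
`(2π)⁻¹ log |x-y|` for `k = 2` and `(k(2-k)ω_k)⁻¹ |x-y|^{2-k}` for `k ≥ 3`, where `ω_k` is the
volume of the unit ball. -/
noncomputable def fundamentalSolution {k : ℕ} (x y : Space k) : ℝ :=
  if k = 2 then (1 / (2 * Real.pi)) * Real.log ‖x - y‖
  else (1 / ((k : ℝ) * (2 - (k : ℝ)) * (volume (Metric.ball (0 : Space k) 1)).toReal))
    * ‖x - y‖ ^ (2 - (k : ℝ))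

/-- The Green function `G_D^k(x,y) = G^k(x,y) - E_x (G^k(B_τ,y))` of the Poisson equation on `D`,
`k ≥ 2`, for `x, y ∈ D`. -/
noncomputable def greenFunction {k : ℕ} {Ω : Type*} [MeasurableSpace Ω] (P : Measure Ω)
    (W : ℝ≥0 → Ω → Space k) (D : Set (Space k)) (x y : Space k) : ℝ :=
  fundamentalSolution x y - ∫ ω, fundamentalSolution (exitPoint D W x ω) y ∂P

/-- The function `y ↦ G_D^k(x,y)` on `D`, extended by `0` to `ℝ^k`. -/
noncomputable def greenSlice {k : ℕ} {Ω : Type*} [MeasurableSpace Ω] (P : Measure Ω)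
    (W : ℝ≥0 → Ω → Space k) (D : Set (Space k)) (x : Space k) : Space k → ℝ :=
  D.indicator (greenFunction P W D x)

/-! ### Lebesgue spaces with mixed norm -/

/-- The iterated norm on functions of `n` real variables: the `L^{p_1}` norm in the first variable
is taken first (innermost), the `L^{p_n}` norm in the last variable is taken last. -/
noncomputable def iteratedNorm : (n : ℕ) → (Fin n → ℝ≥0∞) → ((Fin n → ℝ) → ℝ≥0∞) → ℝ≥0∞
  | 0, _, f => f Fin.elim0
  | n + 1, p, f =>
    eLpNorm (fun t : ℝ => iteratedNorm n (fun i => p i.castSucc)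
      (fun η => f (Fin.snoc (α := fun _ => ℝ) η t))) (p (Fin.last n)) volume

/-- The norm of `L^{p_1,…,p_k}(ℝ^k)`. -/
noncomputable def mixedNorm {k : ℕ} (p : Fin k → ℝ≥0∞) (h : Space k → ℝ) : ℝ≥0∞ :=
  iteratedNorm k p (fun η => ‖h (WithLp.toLp 2 η)‖ₑ)

/-! ### The fractional Brownian field and integration against it -/

/-- The covariance function of a fractional Brownian motion with Hurst parameter `h`. -/
noncomputable def fbmCov (h s t : ℝ) : ℝ :=
  (1 / 2) * (|t| ^ (2 * h) + |s| ^ (2 * h) - |s - t| ^ (2 * h))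

/-- A fractional Brownian field on `ℝ^k` with Hurst parameter `H = (H_1,…,H_k)`. -/
structure IsFractionalBrownianField {k : ℕ} {Ω : Type*} [MeasurableSpace Ω] (H : Fin k → ℝ)
    (B : Space k → Ω → ℝ) (P : Measure Ω) : Prop where
  isGaussian : IsGaussianProcess B P
  mean_zero : ∀ x, ∫ ω, B x ω ∂P = 0
  covariance : ∀ x y, ∫ ω, B x ω * B y ω ∂P = ∏ i, fbmCov (H i) (x i) (y i)

/-- Data of an elementary function: a finite linear combination of indicators of
rectangles `[lo, hi]`. -/
structure Elementary (k : ℕ) where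
  /-- the number of rectangles -/
  num : ℕ
  /-- the coefficients -/
  coeff : Fin num → ℝ
  /-- the lower corners -/
  lo : Fin num → Space k
  /-- the upper corners -/
  hi : Fin num → Space k
  lo_le_hi : ∀ l i, lo l i ≤ hi l i

/-- The rectangle `[a, b]` of `ℝ^k`. -/
def box {k : ℕ} (a b : Space k) : Set (Space k) := {η | ∀ i, a i ≤ η i ∧ η i ≤ b i}

/-- The elementary function `∑ φ_l 1_{[lo_l, hi_l]}`. -/
noncomputable def Elementary.toFun {k : ℕ} (e : Elementary k) (η : Space k) : ℝ :=
  ∑ l, e.coeff l * (box (e.lo l) (e.hi l)).indicator (fun _ => (1 : ℝ)) η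

/-- The increment of the field `B` on the rectangle `[a, b]`: the alternating sum of the values
of `B` at the vertices (`s` is the set of coordinates taken from the lower corner `a`). -/
noncomputable def rectIncrement {k : ℕ} {Ω : Type*} (B : Space k → Ω → ℝ) (a b : Space k)
    (ω : Ω) : ℝ :=
  ∑ s : Finset (Fin k),
    (-1 : ℝ) ^ s.card * B (WithLp.toLp 2 (fun i => if i ∈ s then a i else b i)) ω

/-- The integral `∑ φ_l B([lo_l, hi_l])` of an elementary function against the field `B`. -/
noncomputable def Elementary.integral {k : ℕ} {Ω : Type*} (e : Elementary k)
    (B : Space k → Ω → ℝ) (ω : Ω) : ℝ :=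
  ∑ l, e.coeff l * rectIncrement B (e.lo l) (e.hi l) ω

/-- The point with coordinates `v_i` where `H_i > 1/2`, and `u_i` where `H_i = 1/2`. -/
noncomputable def splice {k : ℕ} (H : Fin k → ℝ) (u : Space k)
    (v : {i : Fin k // 1 / 2 < H i} → ℝ) : Space k :=
  open Classical in
  WithLp.toLp 2 (fun i => if h : 1 / 2 < H i then v ⟨i, h⟩ else u i)

/-- The kernel `∏_{H_i > 1/2} H_i (2 H_i - 1) |u_i - v_i|^{2 H_i - 2}`. -/
noncomputable def hurstKernel {k : ℕ} (H : Fin k → ℝ) (u : Space k)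
    (v : {i : Fin k // 1 / 2 < H i} → ℝ) : ℝ :=
  ∏ i : {i : Fin k // 1 / 2 < H i},
    H i.1 * (2 * H i.1 - 1) * |u i.1 - v i| ^ (2 * H i.1 - 2)

/-- The space `|𝓗^H|` of measurable functions `φ` such that
`∫ du ∫ ∏_{H_i > 1/2} dv_i H_i(2H_i-1)|u_i-v_i|^{2H_i-2} |φ(u)| |φ(w(u,v))| < ∞`, where `w_i = v_i`
if `H_i > 1/2` and `w_i = u_i` if `H_i = 1/2`. -/
def MemAbsH {k : ℕ} (H : Fin k → ℝ) (φ : Space k → ℝ) : Prop :=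
  Measurable φ ∧
    ∫⁻ q : Space k × ({i : Fin k // 1 / 2 < H i} → ℝ),
      ENNReal.ofReal (hurstKernel H q.1 q.2) * ‖φ q.1‖ₑ * ‖φ (splice H q.1 q.2)‖ₑ < ∞

/-- The squared norm `‖φ‖²` in the Hilbert space `𝓗^H` of a function `φ ∈ |𝓗^H|`. -/
noncomputable def hNormSq {k : ℕ} (H : Fin k → ℝ) (φ : Space k → ℝ) : ℝ :=
  ∫ q : Space k × ({i : Fin k // 1 / 2 < H i} → ℝ),
    hurstKernel H q.1 q.2 * φ q.1 * φ (splice H q.1 q.2)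

/-- `Y` is (a version of) the integral `∫ φ dB^H` of the deterministic function `φ ∈ |𝓗^H|`: it is
the `L²(Ω)` limit of the integrals of elementary functions converging to `φ` in `𝓗^H`. -/
def IsFieldIntegral {k : ℕ} {Ω : Type*} [MeasurableSpace Ω] (H : Fin k → ℝ)
    (B : Space k → Ω → ℝ) (P : Measure Ω) (φ : Space k → ℝ) (Y : Ω → ℝ) : Prop :=
  MemAbsH H φ ∧ MemLp Y 2 P ∧
    ∃ e : ℕ → Elementary k,
      Tendsto (fun n => hNormSq H (fun η => (e n).toFun η - φ η)) atTop (𝓝 0) ∧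
      Tendsto (fun n => eLpNorm (fun ω => (e n).integral B ω - Y ω) 2 P) atTop (𝓝 0)

end FracPoisson

/-!
The Green function of a bounded domain is dominated by averages of products of one-dimensional
singularities, which are estimated one variable at a time; the stochastic integral is then the
`L²`-extension of an isometry.

*Domination.* Put `θ = (k - 2) / ∑ H_i`, which is less than one by hypothesis. Since `|z_i - y_i| ≤
|z - y|`, the singularity `|z - y|^{2-k}` is at most `∏ |z_i - y_i|^{-H_i θ}`
(`enorm_fundamentalSolution_le`). The Green function with pole `x` is thus at most an average of
such products over the poles `z = x` and `z = B_τ`, with respect to a measure whose mass does not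
depend on `x` (`enorm_greenSlice_le`). Nothing is used about the law of the exit point, except that
it exists: the exit point is measurable because the paths are continuous (`aemeasurable_exitPoint`).

*Mixed norm.* In the `i`-th variable, `|z_i - y_i|^{-H_i θ}` has a bounded `L^{1/H_i}` norm on
bounded intervals, because `θ < 1`. Minkowski's inequality, applied to one variable after the other,
transfers the bound to averages of products (`iteratedNorm_lintegral_prod_le`).

*The norm of `|𝓗^H|`.* The defining form is bounded on averages as soon as it is bounded on pairs of
products with different poles (`kerForm_lintegral_le`), and on products it factorizes
(`kerForm_prod`). The one-dimensional factors have three singularities, at the two poles and on the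
diagonal. A weighted inequality between arithmetic and geometric means replaces them by sums of
terms with two integrable singularities in independent directions (`singularity_le`,
`exists_kerForm1_sing_le`).

*The integral.* The kernel `|s - t|^{2h-2}` is a positive mixture of the tents `(r - |s - t|)₊`, and
a tent is the measure of the set of windows of width `r` containing both `s` and `t`. The form of
`𝓗^H` is therefore positive semidefinite (`two_mul_kerForm_le`, `hNormSq_nonneg`). On elementary
functions it is the second moment of the integral, since the double integral of the kernel over two
intervals is the covariance of the increments (`integral_elementary_sq`). Elementary functions are
dense in `|𝓗^H|` by Dynkin's theorem and dominated convergence (`isApproximable_of_memAbsH`).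
Completeness of `L²` then gives the existence of the integral (`exists_isFieldIntegral`), and the
isometry its uniqueness (`IsFieldIntegral.ae_eq`) and the bound on its second moment
(`IsFieldIntegral.integral_sq_le`).
-/

namespace FracPoisson

/-! ### Tonelli's theorem for product functions -/

theorem lintegral_fin_nat_prod_eq_prod {n : ℕ} {E : Fin n → Type*}
    {mE : ∀ i, MeasurableSpace (E i)} {μ : (i : Fin n) → Measure (E i)} [∀ i, SigmaFinite (μ i)]
    {f : (i : Fin n) → E i → ℝ≥0∞} (hf : ∀ i, Measurable (f i)) :
    ∫⁻ x : (i : Fin n) → E i, ∏ i, f i (x i) ∂(Measure.pi μ) = ∏ i, ∫⁻ x, f i x ∂(μ i) := by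
  induction n with
  | zero => simp
  | succ n ih =>
    have hprod : Measurable fun x : (i : Fin n) → E (Fin.succ i) =>
        ∏ i : Fin n, f (Fin.succ i) (x i) :=
      Finset.measurable_fun_prod _ fun i _ => (hf _).comp (measurable_pi_apply i)
    have h := ((measurePreserving_piFinSuccAbove μ 0).symm).lintegral_comp_emb
      (MeasurableEquiv.measurableEmbedding _) fun x => ∏ i, f i (x i)
    calc
      _ = ∫⁻ x : E 0 × ((i : Fin n) → E (Fin.succ i)),
            f 0 x.1 * ∏ i : Fin n, f (Fin.succ i) (x.2 i)
            ∂((μ 0).prod (Measure.pi (fun i ↦ μ i.succ))) := by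
        refine h.symm.trans (lintegral_congr fun x => ?_)
        rw [Fin.prod_univ_succ]
        rfl
      _ = (∫⁻ x, f 0 x ∂μ 0)
            * ∏ i : Fin n, ∫⁻ (x : E (Fin.succ i)), f (Fin.succ i) x ∂(μ i.succ) := by
        rw [← ih fun i => hf _,
          ← lintegral_prod_mul (hf 0).aemeasurable hprod.aemeasurable]
      _ = ∏ i, ∫⁻ x, f i x ∂(μ i) := by rw [Fin.prod_univ_succ]

/-- Tonelli's theorem for a product of nonnegative functions of one variable each. -/
theorem lintegral_fintype_prod {ι : Type*} [Fintype ι] {E : ι → Type*}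
    {mE : ∀ i, MeasurableSpace (E i)} {μ : (i : ι) → Measure (E i)} [∀ i, SigmaFinite (μ i)]
    {f : (i : ι) → E i → ℝ≥0∞} (hf : ∀ i, Measurable (f i)) :
    ∫⁻ x : (i : ι) → E i, ∏ i, f i (x i) ∂(Measure.pi μ) = ∏ i, ∫⁻ x, f i x ∂(μ i) := by
  let e := (Fintype.equivFin ι).symm
  rw [← (measurePreserving_piCongrLeft _ e).lintegral_comp_emb
    (MeasurableEquiv.measurableEmbedding _)]
  simp_rw [← e.prod_comp, MeasurableEquiv.coe_piCongrLeft, Equiv.piCongrLeft_apply_apply]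
  exact lintegral_fin_nat_prod_eq_prod fun i => hf _

theorem measurable_prod_apply {ι : Type*} [Fintype ι] {E : ι → Type*}
    [∀ i, MeasurableSpace (E i)] {f : (i : ι) → E i → ℝ≥0∞} (hf : ∀ i, Measurable (f i)) :
    Measurable fun x : (i : ι) → E i => ∏ i, f i (x i) :=
  Finset.measurable_fun_prod _ fun i _ => (hf i).comp (measurable_pi_apply i)

theorem lintegral_volume_fintype_prod {ι α : Type*} [Fintype ι] [MeasureSpace α]
    [SigmaFinite (volume : Measure α)] {f : ι → α → ℝ≥0∞} (hf : ∀ i, Measurable (f i)) :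
    ∫⁻ x : ι → α, ∏ i, f i (x i) = ∏ i, ∫⁻ x, f i x :=
  lintegral_fintype_prod (μ := fun _ => volume) hf

/-! ### The bilinear form of `|𝓗^H|` on nonnegative functions -/

variable {k : ℕ}

/-- The indices with Hurst parameter larger than `1/2`: in these coordinates the noise has
long-range dependence and the kernel of `𝓗^H` is a Riesz kernel, in the others it is the Dirac
kernel. -/
abbrev LongRange (H : Fin k → ℝ) : Type := {i : Fin k // 1 / 2 < H i}

/-- The one-dimensional kernel `h(2h-1)|s-t|^{2h-2}`. -/
noncomputable def kernel1 (h s t : ℝ) : ℝ≥0∞ :=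
  ENNReal.ofReal (h * (2 * h - 1) * |s - t| ^ (2 * h - 2))

theorem measurable_kernel1 (h : ℝ) : Measurable fun p : ℝ × ℝ => kernel1 h p.1 p.2 := by
  unfold kernel1; fun_prop

theorem measurable_kernel1_right (h s : ℝ) : Measurable fun t => kernel1 h s t := by
  unfold kernel1; fun_prop

theorem hurstKernel_nonneg {H : Fin k → ℝ} (u : Space k)
    (v : LongRange H → ℝ) : 0 ≤ hurstKernel H u v := by
  refine Finset.prod_nonneg fun i _ => ?_
  have := i.2
  have : 0 ≤ H i.1 * (2 * H i.1 - 1) := mul_nonneg (by linarith) (by linarith)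
  positivity

theorem ofReal_hurstKernel {H : Fin k → ℝ} (u : Space k) (v : LongRange H → ℝ) :
    ENNReal.ofReal (hurstKernel H u v) = ∏ i : LongRange H, kernel1 (H i.1) (u i.1) (v i) := by
  rw [hurstKernel, ENNReal.ofReal_prod_of_nonneg]
  · rfl
  · intro i _
    have := i.2
    have : 0 ≤ H i.1 * (2 * H i.1 - 1) := mul_nonneg (by linarith) (by linarith)
    positivity

theorem measurable_splice (H : Fin k → ℝ) :
    Measurable fun q : Space k × (LongRange H → ℝ) => splice H q.1 q.2 := by
  unfold splice
  refine (WithLp.measurable_toLp 2 _).comp ?_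
  refine measurable_pi_lambda _ fun i => ?_
  by_cases h : 1 / 2 < H i
  · simp only [h, dite_true]; fun_prop
  · simp only [h, dite_false]; fun_prop

theorem measurable_hurstKernel (H : Fin k → ℝ) :
    Measurable fun q : Space k × (LongRange H → ℝ) => hurstKernel H q.1 q.2 := by
  unfold hurstKernel
  fun_prop

theorem splice_apply_of_lt {H : Fin k → ℝ} (u : Space k) (v : LongRange H → ℝ) {i : Fin k}
    (h : 1 / 2 < H i) : splice H u v i = v ⟨i, h⟩ := by
  simp only [splice]; exact dif_pos h

theorem splice_apply_of_not_lt {H : Fin k → ℝ} (u : Space k) (v : LongRange H → ℝ) {i : Fin k}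
    (h : ¬ 1 / 2 < H i) : splice H u v i = u i := by
  simp only [splice]; exact dif_neg h

/-- The bilinear form of `|𝓗^H|` on nonnegative functions, with values in `[0, ∞]`. In the
coordinates with `H_i = 1/2` the two arguments are evaluated at the same point. -/
noncomputable def kerForm (H : Fin k → ℝ) (F G : Space k → ℝ≥0∞) : ℝ≥0∞ :=
  ∫⁻ q : Space k × (LongRange H → ℝ),
    ENNReal.ofReal (hurstKernel H q.1 q.2) * F q.1 * G (splice H q.1 q.2)

/-- The one-dimensional version of `kerForm`: the kernel is `h(2h-1)|s-t|^{2h-2}` for `h > 1/2`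
and the Dirac kernel for `h = 1/2`. -/
noncomputable def kerForm1 (h : ℝ) (f g : ℝ → ℝ≥0∞) : ℝ≥0∞ :=
  open Classical in
  if 1 / 2 < h then ∫⁻ s, ∫⁻ t, kernel1 h s t * f s * g t else ∫⁻ s, f s * g s

theorem kerForm_eq_lintegral_pi (H : Fin k → ℝ) {F G : Space k → ℝ≥0∞} (hF : Measurable F)
    (hG : Measurable G) :
    kerForm H F G = ∫⁻ u : Fin k → ℝ, ∫⁻ v : LongRange H → ℝ,
      (∏ i : LongRange H, kernel1 (H i.1) (u i.1) (v i)) * F (WithLp.toLp 2 u) *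
        G (splice H (WithLp.toLp 2 u) v) := by
  have hm : Measurable fun q : Space k × (LongRange H → ℝ) =>
      ENNReal.ofReal (hurstKernel H q.1 q.2) * F q.1 * G (splice H q.1 q.2) :=
    ((measurable_hurstKernel H).ennreal_ofReal.mul (hF.comp measurable_fst)).mul
      (hG.comp (measurable_splice H))
  rw [kerForm, Measure.volume_eq_prod, lintegral_prod _ hm.aemeasurable,
    ← (PiLp.volume_preserving_toLp (Fin k)).lintegral_comp hm.lintegral_prod_right']
  simp only [ofReal_hurstKernel]

/-- On product functions the form factorizes into one-dimensional forms. -/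
theorem kerForm_prod (H : Fin k → ℝ) {f g : Fin k → ℝ → ℝ≥0∞} (hf : ∀ i, Measurable (f i))
    (hg : ∀ i, Measurable (g i)) :
    kerForm H (fun u => ∏ i, f i (u i)) (fun u => ∏ i, g i (u i)) =
      ∏ i, kerForm1 (H i) (f i) (g i) := by
  classical
  have hF : Measurable fun u : Space k => ∏ i, f i (u i) :=
    Finset.measurable_fun_prod _ fun i _ => (hf i).comp (by fun_prop)
  have hG : Measurable fun u : Space k => ∏ i, g i (u i) :=
    Finset.measurable_fun_prod _ fun i _ => (hg i).comp (by fun_prop)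
  rw [kerForm_eq_lintegral_pi H hF hG]
  have hm : ∀ i, Measurable fun p : ℝ × ℝ => kernel1 (H i) p.1 p.2 * f i p.1 * g i p.2 :=
    fun i => ((measurable_kernel1 _).mul ((hf i).comp measurable_fst)).mul
      ((hg i).comp measurable_snd)
  -- the result of integrating out `v_i`, if there is such a variable
  set X : Fin k → ℝ → ℝ≥0∞ := fun i s =>
    if 1 / 2 < H i then ∫⁻ t, kernel1 (H i) s t * f i s * g i t else f i s * g i s with hX
  have hXm : ∀ i, Measurable (X i) := by
    intro i
    by_cases h : 1 / 2 < H i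
    · simp only [hX, h, if_true]; exact (hm i).lintegral_prod_right'
    · simp only [hX, h, if_false]; exact (hf i).mul (hg i)
  have key : ∀ u : Fin k → ℝ, ∫⁻ v : LongRange H → ℝ,
      (∏ i : LongRange H, kernel1 (H i.1) (u i.1) (v i)) * (∏ i, f i (u i)) *
        (∏ i, g i (splice H (WithLp.toLp 2 u) v i)) = ∏ i, X i (u i) := by
    intro u
    have h1 : ∀ v : LongRange H → ℝ, (∏ i : LongRange H, kernel1 (H i.1) (u i.1) (v i)) *
        (∏ i, f i (u i)) * (∏ i, g i (splice H (WithLp.toLp 2 u) v i)) =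
        (∏ i : LongRange H, kernel1 (H i.1) (u i.1) (v i) * f i.1 (u i.1) * g i.1 (v i)) *
          ∏ i : {i : Fin k // ¬ 1 / 2 < H i}, f i.1 (u i.1) * g i.1 (u i.1) := by
      intro v
      rw [← Fintype.prod_subtype_mul_prod_subtype (fun i => 1 / 2 < H i) (fun i => f i (u i)),
        ← Fintype.prod_subtype_mul_prod_subtype (fun i => 1 / 2 < H i)
          (fun i => g i (splice H (WithLp.toLp 2 u) v i))]
      have e1 : ∀ i : LongRange H, splice H (WithLp.toLp 2 u) v i.1 = v i :=
        fun i => splice_apply_of_lt _ _ i.2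
      have e2 : ∀ i : {i : Fin k // ¬ 1 / 2 < H i},
          splice H (WithLp.toLp 2 u) v i.1 = u i.1 := fun i => splice_apply_of_not_lt _ _ i.2
      simp only [e1, e2, Finset.prod_mul_distrib]
      ring
    simp only [h1]
    have hm' : ∀ i : LongRange H, Measurable fun t =>
        kernel1 (H i.1) (u i.1) t * f i.1 (u i.1) * g i.1 t :=
      fun i => ((measurable_kernel1_right _ _).mul_const _).mul (hg i.1)
    rw [lintegral_mul_const _ (measurable_prod_apply hm'), lintegral_volume_fintype_prod hm',
      ← Fintype.prod_subtype_mul_prod_subtype (fun i => 1 / 2 < H i) (fun i => X i (u i))]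
    congr 1
    · exact Finset.prod_congr rfl fun i _ => by simp only [hX]; rw [if_pos i.2]
    · exact Finset.prod_congr rfl fun i _ => by simp only [hX]; rw [if_neg i.2]
  simp only [key]
  rw [lintegral_volume_fintype_prod hXm]
  refine Finset.prod_congr rfl fun i _ => ?_
  simp only [hX, kerForm1]
  split_ifs <;> rfl

end FracPoisson

namespace FracPoisson

/-! ### Tent decomposition of the Riesz kernel -/

/-- The weight of a window of width `r` in the tent decomposition of `h(2h-1)|s-t|^{2h-2}`. -/
noncomputable def tentWeight (h r : ℝ) : ℝ :=
  h * (2 * h - 1) * (2 - 2 * h) * (3 - 2 * h) * r ^ (2 * h - 4)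

theorem tentWeight_nonneg {h r : ℝ} (h1 : 1 / 2 < h) (h2 : h < 1) (hr : 0 ≤ r) :
    0 ≤ tentWeight h r :=
  mul_nonneg (mul_nonneg (mul_nonneg (mul_nonneg (by linarith) (by linarith)) (by linarith))
    (by linarith)) (Real.rpow_nonneg hr _)

/-- The factor of the tent decomposition of the kernel `h(2h-1)|s-t|^{2h-2}`: for a window
`θ = (r, c)` of width `r` and centre `c`, the indicator that `s` lies in the window times the square
root of the weight of the window. -/
noncomputable def tent (h s : ℝ) (θ : ℝ × ℝ) : ℝ≥0∞ :=
  (Ioo (s - θ.1 / 2) (s + θ.1 / 2)).indicator (fun _ => ENNReal.ofReal √(tentWeight h θ.1)) θ.2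

theorem measurable_tent (h : ℝ) : Measurable fun q : ℝ × ℝ × ℝ => tent h q.1 q.2 := by
  have hS : MeasurableSet {q : ℝ × ℝ × ℝ | q.1 - q.2.1 / 2 < q.2.2 ∧ q.2.2 < q.1 + q.2.1 / 2} :=
    MeasurableSet.inter
      (measurableSet_lt (f := fun q : ℝ × ℝ × ℝ => q.1 - q.2.1 / 2) (g := fun q => q.2.2)
        (by fun_prop) (by fun_prop))
      (measurableSet_lt (f := fun q : ℝ × ℝ × ℝ => q.2.2) (g := fun q => q.1 + q.2.1 / 2)
        (by fun_prop) (by fun_prop))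
  have hw : Measurable fun q : ℝ × ℝ × ℝ => ENNReal.ofReal √(tentWeight h q.2.1) := by
    unfold tentWeight; fun_prop
  exact hw.indicator hS

theorem measurable_tent_left (h s : ℝ) : Measurable (tent h s) :=
  (measurable_tent h).comp (measurable_prodMk_left (x := s))

/-- The Riesz kernel as a mixture of the tents `(r - x)₊`; the constant in `tentWeight` is chosen to
make this exact. -/
theorem lintegral_Ioi_tentWeight {h x : ℝ} (h1 : 1 / 2 < h) (h2 : h < 1) (hx : 0 < x) :
    ∫⁻ r in Ioi x, ENNReal.ofReal (tentWeight h r) * ENNReal.ofReal (r - x) =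
      ENNReal.ofReal (h * (2 * h - 1) * x ^ (2 * h - 2)) := by
  set c := h * (2 * h - 1) * (2 - 2 * h) * (3 - 2 * h) with hc
  have hpow : ∀ r : ℝ, 0 < r → r ^ (2 * h - 3) = r ^ (2 * h - 4) * r := by
    intro r hr
    rw [← Real.rpow_add_one hr.ne']; congr 1; ring
  have e0 : ∀ r, 0 < r → tentWeight h r * (r - x) =
      c * r ^ (2 * h - 3) - c * x * r ^ (2 * h - 4) := by
    intro r hr
    rw [hpow r hr, tentWeight, ← hc]; ring
  have e1 : ∀ r ∈ Ioi x, ENNReal.ofReal (tentWeight h r) * ENNReal.ofReal (r - x) =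
      ENNReal.ofReal (c * r ^ (2 * h - 3) - c * x * r ^ (2 * h - 4)) := by
    intro r hr
    have hr0 : 0 < r := hx.trans hr
    rw [← ENNReal.ofReal_mul (tentWeight_nonneg h1 h2 hr0.le), e0 r hr0]
  have i1 : IntegrableOn (fun r : ℝ => c * r ^ (2 * h - 3)) (Ioi x) :=
    (integrableOn_Ioi_rpow_of_lt (by linarith) hx).const_mul _
  have i2 : IntegrableOn (fun r : ℝ => c * x * r ^ (2 * h - 4)) (Ioi x) :=
    (integrableOn_Ioi_rpow_of_lt (by linarith) hx).const_mul _
  have i3 : Integrable (fun r : ℝ => c * r ^ (2 * h - 3) - c * x * r ^ (2 * h - 4))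
      (volume.restrict (Ioi x)) := i1.sub i2
  have hpos : 0 ≤ᵐ[volume.restrict (Ioi x)]
      fun r : ℝ => c * r ^ (2 * h - 3) - c * x * r ^ (2 * h - 4) := by
    filter_upwards [ae_restrict_mem measurableSet_Ioi] with r hr
    have hr0 : 0 < r := hx.trans hr
    rw [Pi.zero_apply, ← e0 r hr0]
    exact mul_nonneg (tentWeight_nonneg h1 h2 hr0.le) (sub_nonneg.2 (le_of_lt hr))
  rw [setLIntegral_congr_fun measurableSet_Ioi e1,
    ← ofReal_integral_eq_lintegral_ofReal i3 hpos]
  congr 1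
  rw [integral_sub i1 i2, integral_const_mul, integral_const_mul,
    integral_Ioi_rpow_of_lt (by linarith) hx, integral_Ioi_rpow_of_lt (by linarith) hx]
  have e3 : x ^ (2 * h - 4 + 1) * x = x ^ (2 * h - 3 + 1) := by
    rw [← Real.rpow_add_one hx.ne']; congr 1; ring
  have e4 : x ^ (2 * h - 2) = x ^ (2 * h - 3 + 1) := by congr 1; ring
  rw [e4, ← e3, hc]
  generalize x ^ (2 * h - 4 + 1) = X
  have d1 : 2 * h - 3 + 1 = -(2 - 2 * h) := by ring
  have d2 : 2 * h - 4 + 1 = -(3 - 2 * h) := by ring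
  have n1 : 2 - 2 * h ≠ 0 := by linarith
  have n2 : 3 - 2 * h ≠ 0 := by linarith
  have hAB : 3 - 2 * h = 2 - 2 * h + 1 := by ring
  rw [d1, d2]
  generalize 2 - 2 * h = A at *
  generalize 3 - 2 * h = B at *
  subst hAB
  field_simp
  ring

/-- The Riesz kernel is a superposition of tents: `|s-t|^{2h-2}` is a multiple of
`∫ r^{2h-4} (r - |s-t|)₊ dr`, and `(r - |s-t|)₊` is the measure of the set of centres of windows of
width `r` that contain both `s` and `t`. -/
theorem kernel1_eq_lintegral_tent {h s t : ℝ} (h1 : 1 / 2 < h) (h2 : h < 1) (hst : s ≠ t) :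
    kernel1 h s t = ∫⁻ θ : ℝ × ℝ, tent h s θ * tent h t θ := by
  have hm : Measurable fun θ : ℝ × ℝ => tent h s θ * tent h t θ :=
    (measurable_tent_left h s).mul (measurable_tent_left h t)
  have hx : 0 < |s - t| := abs_pos.2 (sub_ne_zero.2 hst)
  rw [Measure.volume_eq_prod, lintegral_prod _ hm.aemeasurable, kernel1,
    ← lintegral_Ioi_tentWeight h1 h2 hx, ← lintegral_indicator measurableSet_Ioi]
  refine lintegral_congr fun r => ?_
  have e : ∀ y, tent h s (r, y) * tent h t (r, y) =
      (Ioo (s - r / 2) (s + r / 2) ∩ Ioo (t - r / 2) (t + r / 2)).indicator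
        (fun _ => ENNReal.ofReal √(tentWeight h r) * ENNReal.ofReal √(tentWeight h r)) y := by
    intro y
    simp only [tent]
    exact (Set.inter_indicator_mul _ _ _).symm
  have hlen : min (s + r / 2) (t + r / 2) - max (s - r / 2) (t - r / 2) = r - |s - t| := by
    rcases le_total s t with hh | hh
    · rw [min_eq_left (by linarith), max_eq_right (by linarith), abs_of_nonpos (by linarith)]; ring
    · rw [min_eq_right (by linarith), max_eq_left (by linarith), abs_of_nonneg (by linarith)]; ring
  simp only [e]
  rw [lintegral_indicator (measurableSet_Ioo.inter measurableSet_Ioo), setLIntegral_const,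
    Ioo_inter_Ioo, Real.volume_Ioo, hlen]
  by_cases hr : |s - t| < r
  · have hw := tentWeight_nonneg h1 h2 (hx.trans hr).le
    rw [indicator_of_mem (by exact hr), ← ENNReal.ofReal_mul (Real.sqrt_nonneg _),
      Real.mul_self_sqrt hw]
  · rw [indicator_of_notMem (by exact hr), ENNReal.ofReal_of_nonpos (p := r - |s - t|)
      (by linarith), mul_zero]

/-! ### Positive semidefiniteness of the form -/

variable {k : ℕ} {H : Fin k → ℝ}

/-- The point with coordinates `s i` where `H i > 1/2` and `p i` elsewhere. -/
noncomputable def joinCoord (H : Fin k → ℝ) (s : LongRange H → ℝ)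
    (p : {i : Fin k // ¬ 1 / 2 < H i} → ℝ) : Space k :=
  open Classical in
  WithLp.toLp 2 (fun i => if h : 1 / 2 < H i then s ⟨i, h⟩ else p ⟨i, h⟩)

theorem measurable_joinCoord (H : Fin k → ℝ) :
    Measurable fun q : (LongRange H → ℝ) × ({i : Fin k // ¬ 1 / 2 < H i} → ℝ) =>
      joinCoord H q.1 q.2 := by
  unfold joinCoord
  refine (WithLp.measurable_toLp 2 _).comp ?_
  refine measurable_pi_lambda _ fun i => ?_
  by_cases h : 1 / 2 < H i
  · simp only [h, dite_true]; fun_prop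
  · simp only [h, dite_false]; fun_prop

theorem splice_joinCoord (s v : LongRange H → ℝ) (p : {i : Fin k // ¬ 1 / 2 < H i} → ℝ) :
    splice H (joinCoord H s p) v = joinCoord H v p := by
  classical
  ext i
  by_cases h : 1 / 2 < H i
  · rw [splice_apply_of_lt _ _ h]
    simp only [joinCoord, h, dite_true]
  · rw [splice_apply_of_not_lt _ _ h]
    simp only [joinCoord, h, dite_false]

theorem joinCoord_apply_longRange (s : LongRange H → ℝ) (p : {i : Fin k // ¬ 1 / 2 < H i} → ℝ)
    (i : LongRange H) : joinCoord H s p i.1 = s i := by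
  simp only [joinCoord]; exact dif_pos i.2

/-- The product of the tent factors over the coordinates with `H i > 1/2`. -/
noncomputable def tentProd (H : Fin k → ℝ) (s : LongRange H → ℝ) (θ : LongRange H → ℝ × ℝ) : ℝ≥0∞ :=
  ∏ i, tent (H i.1) (s i) (θ i)

theorem measurable_tentProd (H : Fin k → ℝ) :
    Measurable fun q : (LongRange H → ℝ) × (LongRange H → ℝ × ℝ) => tentProd H q.1 q.2 :=
  Finset.measurable_fun_prod _ fun i _ => (measurable_tent (H i.1)).comp
    (f := fun q : (LongRange H → ℝ) × (LongRange H → ℝ × ℝ) => (q.1 i, q.2 i)) (by fun_prop)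

theorem prod_kernel1_eq_lintegral_tentProd (h2 : ∀ i, H i < 1) {s t : LongRange H → ℝ}
    (hst : ∀ i, s i ≠ t i) :
    ∏ i : LongRange H, kernel1 (H i.1) (s i) (t i) =
      ∫⁻ θ : LongRange H → ℝ × ℝ, tentProd H s θ * tentProd H t θ := by
  simp only [tentProd, ← Finset.prod_mul_distrib]
  rw [lintegral_volume_fintype_prod (f := fun i θ => tent (H i.1) (s i) θ * tent (H i.1) (t i) θ)
    fun i => (measurable_tent_left _ _).mul (measurable_tent_left _ _)]
  exact Finset.prod_congr rfl fun i _ => kernel1_eq_lintegral_tent i.2 (h2 i.1) (hst i)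

/-- Almost every point avoids the diagonals, where the value `0 ^ (2h-2) = 0` of the kernel is
meaningless. -/
theorem ae_forall_apply_ne {ι : Type*} [Fintype ι] (s : ι → ℝ) :
    ∀ᵐ t : ι → ℝ, ∀ i, s i ≠ t i := by
  rw [ae_all_iff]
  intro i
  rw [ae_iff]
  simp only [ne_eq, not_not]
  have := Measure.pi_hyperplane (fun _ : ι => (volume : Measure ℝ)) i (s i)
  rw [volume_pi]
  convert this using 4
  exact eq_comm

/-- The integral of `F` against the product of windows `q.2`, with the coordinates without a kernel
frozen at `q.1`. -/
noncomputable def amplitude (H : Fin k → ℝ) (F : Space k → ℝ≥0∞)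
    (q : ({i : Fin k // ¬ 1 / 2 < H i} → ℝ) × (LongRange H → ℝ × ℝ)) : ℝ≥0∞ :=
  ∫⁻ s : LongRange H → ℝ, tentProd H s q.2 * F (joinCoord H s q.1)

theorem measurable_tentProd_mul (H : Fin k → ℝ) {F : Space k → ℝ≥0∞} (hF : Measurable F) :
    Measurable fun x : (({i : Fin k // ¬ 1 / 2 < H i} → ℝ) × (LongRange H → ℝ × ℝ)) ×
      (LongRange H → ℝ) => tentProd H x.2 x.1.2 * F (joinCoord H x.2 x.1.1) := by
  refine Measurable.mul ?_ (hF.comp ?_)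
  · exact (measurable_tentProd H).comp
      (measurable_snd.prodMk (measurable_snd.comp measurable_fst))
  · exact (measurable_joinCoord H).comp
      (measurable_snd.prodMk (measurable_fst.comp measurable_fst))

theorem measurable_amplitude (H : Fin k → ℝ) {F : Space k → ℝ≥0∞} (hF : Measurable F) :
    Measurable (amplitude H F) :=
  (measurable_tentProd_mul H hF).lintegral_prod_right'

theorem lintegral_eq_lintegral_joinCoord (H : Fin k → ℝ) {F : Space k → ℝ≥0∞}
    (hF : Measurable F) :
    ∫⁻ u : Fin k → ℝ, F (WithLp.toLp 2 u) =
      ∫⁻ p : {i : Fin k // ¬ 1 / 2 < H i} → ℝ, ∫⁻ s : LongRange H → ℝ, F (joinCoord H s p) := by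
  classical
  have h := (volume_preserving_piEquivPiSubtypeProd (fun _ : Fin k => ℝ)
    (fun i => 1 / 2 < H i)).symm.lintegral_comp (hF.comp (WithLp.measurable_toLp 2 _))
  have h' := lintegral_prod_symm' (μ := (volume : Measure (LongRange H → ℝ)))
    (ν := (volume : Measure ({i : Fin k // ¬ 1 / 2 < H i} → ℝ)))
    (fun q => F (joinCoord H q.1 q.2)) (hF.comp (measurable_joinCoord H))
  rw [← h', ← Measure.volume_eq_prod]
  exact h.symm

/-- `kerForm_eq_lintegral_amplitude` in the coordinates with `H i > 1/2`. -/
theorem lintegral_lintegral_tentProd (h2 : ∀ i, H i < 1) {F G : (LongRange H → ℝ) → ℝ≥0∞}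
    (hF : Measurable F) (hG : Measurable G) :
    ∫⁻ s : LongRange H → ℝ, ∫⁻ v : LongRange H → ℝ,
        (∏ i : LongRange H, kernel1 (H i.1) (s i) (v i)) * F s * G v =
      ∫⁻ θ : LongRange H → ℝ × ℝ, (∫⁻ s, tentProd H s θ * F s) * ∫⁻ v, tentProd H v θ * G v := by
  have hts : ∀ s, Measurable fun θ : LongRange H → ℝ × ℝ => tentProd H s θ := fun s =>
    (measurable_tentProd H).comp (measurable_prodMk_left (x := s))
  have hst : ∀ θ, Measurable fun s : LongRange H → ℝ => tentProd H s θ := fun θ =>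
    (measurable_tentProd H).comp (measurable_prodMk_right (y := θ))
  have m1 : ∀ {F : (LongRange H → ℝ) → ℝ≥0∞}, Measurable F →
      Measurable fun x : (LongRange H → ℝ) × (LongRange H → ℝ × ℝ) => tentProd H x.1 x.2 * F x.1 :=
    fun hF => (measurable_tentProd H).mul (hF.comp measurable_fst)
  have m2 : ∀ {F : (LongRange H → ℝ) → ℝ≥0∞}, Measurable F →
      Measurable fun θ : LongRange H → ℝ × ℝ => ∫⁻ s, tentProd H s θ * F s :=
    fun hF => (m1 hF).lintegral_prod_left'
  calc ∫⁻ s : LongRange H → ℝ, ∫⁻ v : LongRange H → ℝ,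
        (∏ i : LongRange H, kernel1 (H i.1) (s i) (v i)) * F s * G v
      = ∫⁻ s : LongRange H → ℝ, ∫⁻ v : LongRange H → ℝ, ∫⁻ θ : LongRange H → ℝ × ℝ,
          (tentProd H s θ * F s) * (tentProd H v θ * G v) := by
        refine lintegral_congr fun s => lintegral_congr_ae ?_
        filter_upwards [ae_forall_apply_ne s] with v hv
        have m3 : Measurable fun θ => tentProd H s θ * tentProd H v θ := (hts s).mul (hts v)
        rw [prod_kernel1_eq_lintegral_tentProd h2 hv, mul_assoc, ← lintegral_mul_const _ m3]
        exact lintegral_congr fun θ => by ring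
    _ = ∫⁻ s : LongRange H → ℝ, ∫⁻ θ : LongRange H → ℝ × ℝ, ∫⁻ v : LongRange H → ℝ,
          (tentProd H s θ * F s) * (tentProd H v θ * G v) := by
        refine lintegral_congr fun s => lintegral_lintegral_swap ?_
        have m3 : Measurable fun x : (LongRange H → ℝ) × (LongRange H → ℝ × ℝ) =>
            tentProd H s x.2 * F s := ((hts s).comp measurable_snd).mul_const _
        exact (m3.mul (m1 hG)).aemeasurable
    _ = ∫⁻ s : LongRange H → ℝ, ∫⁻ θ : LongRange H → ℝ × ℝ,
          (tentProd H s θ * F s) * ∫⁻ v, tentProd H v θ * G v := by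
        refine lintegral_congr fun s => lintegral_congr fun θ => ?_
        exact lintegral_const_mul _ ((hst θ).mul hG)
    _ = ∫⁻ θ : LongRange H → ℝ × ℝ, ∫⁻ s : LongRange H → ℝ,
          (tentProd H s θ * F s) * ∫⁻ v, tentProd H v θ * G v := by
        refine lintegral_lintegral_swap ?_
        exact ((m1 hF).mul ((m2 hG).comp measurable_snd)).aemeasurable
    _ = _ := by
        refine lintegral_congr fun θ => ?_
        exact lintegral_mul_const _ ((hst θ).mul hF)

/-- The form `kerForm` is a superposition of products of amplitudes; this is what makes it symmetric
and positive semidefinite. -/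
theorem kerForm_eq_lintegral_amplitude (h2 : ∀ i, H i < 1) {F G : Space k → ℝ≥0∞}
    (hF : Measurable F) (hG : Measurable G) :
    kerForm H F G = ∫⁻ q, amplitude H F q * amplitude H G q := by
  have hker : Measurable fun x : Space k × (LongRange H → ℝ) =>
      ∏ i : LongRange H, kernel1 (H i.1) (x.1 i.1) (x.2 i) := by
    unfold kernel1
    fun_prop
  have hm : Measurable fun x : Space k × (LongRange H → ℝ) =>
      (∏ i : LongRange H, kernel1 (H i.1) (x.1 i.1) (x.2 i)) * F x.1 * G (splice H x.1 x.2) :=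
    (hker.mul (hF.comp measurable_fst)).mul (hG.comp (measurable_splice H))
  have hj : ∀ p, Measurable fun s : LongRange H → ℝ => joinCoord H s p := fun p =>
    (measurable_joinCoord H).comp (measurable_prodMk_right (y := p))
  have hAA : Measurable fun q => amplitude H F q * amplitude H G q :=
    (measurable_amplitude H hF).mul (measurable_amplitude H hG)
  have h1 := lintegral_eq_lintegral_joinCoord H
    (hm.lintegral_prod_right' (ν := (volume : Measure (LongRange H → ℝ))))
  rw [kerForm_eq_lintegral_pi H hF hG, Measure.volume_eq_prod,
    lintegral_prod _ hAA.aemeasurable]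
  refine h1.trans (lintegral_congr fun p => ?_)
  simp only [joinCoord_apply_longRange, splice_joinCoord]
  exact lintegral_lintegral_tentProd h2 (hF.comp (hj p)) (hG.comp (hj p))

theorem kerForm_comm (h2 : ∀ i, H i < 1) {F G : Space k → ℝ≥0∞}
    (hF : Measurable F) (hG : Measurable G) : kerForm H F G = kerForm H G F := by
  rw [kerForm_eq_lintegral_amplitude h2 hF hG, kerForm_eq_lintegral_amplitude h2 hG hF]
  simp only [mul_comm]

theorem two_mul_le_add_sq_ennreal (a b : ℝ≥0∞) : 2 * (a * b) ≤ a * a + b * b := by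
  induction a with
  | top => simp
  | coe a =>
    induction b with
    | top => simp
    | coe b =>
      norm_cast
      have := two_mul_le_add_sq a b
      nlinarith [this]

/-- Positive semidefiniteness of `kerForm`, in the form available for nonnegative functions. -/
theorem two_mul_kerForm_le (h2 : ∀ i, H i < 1) {F G : Space k → ℝ≥0∞}
    (hF : Measurable F) (hG : Measurable G) :
    2 * kerForm H F G ≤ kerForm H F F + kerForm H G G := by
  have mFF : Measurable fun q => amplitude H F q * amplitude H F q :=
    (measurable_amplitude H hF).mul (measurable_amplitude H hF)
  have mFG : Measurable fun q => amplitude H F q * amplitude H G q :=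
    (measurable_amplitude H hF).mul (measurable_amplitude H hG)
  rw [kerForm_eq_lintegral_amplitude h2 hF hG, kerForm_eq_lintegral_amplitude h2 hF hF,
    kerForm_eq_lintegral_amplitude h2 hG hG, ← lintegral_add_left mFF,
    ← lintegral_const_mul _ mFG]
  exact lintegral_mono fun q => two_mul_le_add_sq_ennreal _ _

end FracPoisson

namespace FracPoisson

/-! ### The space `|𝓗^H|` and its quadratic form -/

variable {k : ℕ} {H : Fin k → ℝ}

theorem measurable_kerForm_integrand (H : Fin k → ℝ) {F G : Space k → ℝ≥0∞} (hF : Measurable F)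
    (hG : Measurable G) :
    Measurable fun q : Space k × (LongRange H → ℝ) =>
      ENNReal.ofReal (hurstKernel H q.1 q.2) * F q.1 * G (splice H q.1 q.2) :=
  ((measurable_hurstKernel H).ennreal_ofReal.mul (hF.comp measurable_fst)).mul
    (hG.comp (measurable_splice H))

theorem kerForm_mono {F F' G G' : Space k → ℝ≥0∞} (hF : ∀ u, F u ≤ F' u) (hG : ∀ u, G u ≤ G' u) :
    kerForm H F G ≤ kerForm H F' G' :=
  lintegral_mono fun _ => mul_le_mul' (mul_le_mul' le_rfl (hF _)) (hG _)

theorem kerForm_add_left {F F' G : Space k → ℝ≥0∞} (hF : Measurable F) (hG : Measurable G) :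
    kerForm H (fun u => F u + F' u) G = kerForm H F G + kerForm H F' G := by
  unfold kerForm
  rw [← lintegral_add_left (measurable_kerForm_integrand H hF hG)]
  exact lintegral_congr fun q => by ring

theorem kerForm_add_right {F G G' : Space k → ℝ≥0∞} (hF : Measurable F) (hG : Measurable G) :
    kerForm H F (fun u => G u + G' u) = kerForm H F G + kerForm H F G' := by
  unfold kerForm
  rw [← lintegral_add_left (measurable_kerForm_integrand H hF hG)]
  exact lintegral_congr fun q => by ring

theorem kerForm_lt_top_of_self (h2 : ∀ i, H i < 1) {F G : Space k → ℝ≥0∞}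
    (hF : Measurable F) (hG : Measurable G) (hFF : kerForm H F F < ∞) (hGG : kerForm H G G < ∞) :
    kerForm H F G < ∞ := by
  have h := two_mul_kerForm_le h2 hF hG
  refine lt_of_le_of_lt ?_ (ENNReal.add_lt_top.2 ⟨hFF, hGG⟩)
  refine le_trans ?_ h
  rw [two_mul]
  exact le_self_add

theorem memAbsH_iff {f : Space k → ℝ} :
    MemAbsH H f ↔ Measurable f ∧ kerForm H (fun u => ‖f u‖ₑ) (fun u => ‖f u‖ₑ) < ∞ := Iff.rfl

theorem MemAbsH.mono {f g : Space k → ℝ} (hg : MemAbsH H g) (hf : Measurable f)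
    (h : ∀ u, ‖f u‖ₑ ≤ ‖g u‖ₑ) : MemAbsH H f :=
  ⟨hf, (kerForm_mono h h).trans_lt hg.2⟩

theorem MemAbsH.add (h2 : ∀ i, H i < 1) {f g : Space k → ℝ} (hf : MemAbsH H f)
    (hg : MemAbsH H g) : MemAbsH H (fun u => f u + g u) := by
  refine ⟨hf.1.add hg.1, ?_⟩
  have mf := hf.1.enorm
  have mg := hg.1.enorm
  have hle : ∀ u, ‖f u + g u‖ₑ ≤ ‖f u‖ₑ + ‖g u‖ₑ := fun u => enorm_add_le _ _
  refine (kerForm_mono hle hle).trans_lt ?_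
  have mfg : Measurable fun u => ‖f u‖ₑ + ‖g u‖ₑ := mf.add mg
  rw [kerForm_add_left mf mfg, kerForm_add_right mf mf, kerForm_add_right mg mf]
  have a := kerForm_lt_top_of_self h2 mf mg hf.2 hg.2
  have b := kerForm_lt_top_of_self h2 mg mf hg.2 hf.2
  have c := hf.2
  have d := hg.2
  exact ENNReal.add_lt_top.2 ⟨ENNReal.add_lt_top.2 ⟨c, a⟩, ENNReal.add_lt_top.2 ⟨b, d⟩⟩

theorem MemAbsH.const_mul {f : Space k → ℝ} (hf : MemAbsH H f) (c : ℝ) :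
    MemAbsH H (fun u => c * f u) := by
  refine ⟨hf.1.const_mul c, ?_⟩
  have e : (∫⁻ q : Space k × (LongRange H → ℝ), ENNReal.ofReal (hurstKernel H q.1 q.2) *
      ‖c * f q.1‖ₑ * ‖c * f (splice H q.1 q.2)‖ₑ) =
      (‖c‖ₑ * ‖c‖ₑ) * kerForm H (fun u => ‖f u‖ₑ) (fun u => ‖f u‖ₑ) := by
    rw [kerForm, ← lintegral_const_mul _ (measurable_kerForm_integrand H hf.1.enorm hf.1.enorm)]
    refine lintegral_congr fun q => ?_
    rw [enorm_mul, enorm_mul]; ring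
  rw [e]
  exact ENNReal.mul_lt_top (ENNReal.mul_lt_top enorm_lt_top enorm_lt_top) hf.2

theorem MemAbsH.neg {f : Space k → ℝ} (hf : MemAbsH H f) : MemAbsH H (fun u => - f u) :=
  hf.mono hf.1.neg fun u => by rw [enorm_neg]

theorem MemAbsH.sub (h2 : ∀ i, H i < 1) {f g : Space k → ℝ} (hf : MemAbsH H f)
    (hg : MemAbsH H g) : MemAbsH H (fun u => f u - g u) := by
  simpa only [sub_eq_add_neg] using hf.add h2 hg.neg

theorem memAbsH_zero : MemAbsH H (fun _ => 0) := ⟨measurable_const, by simp⟩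

theorem MemAbsH.sum (h2 : ∀ i, H i < 1) {ι : Type*} (s : Finset ι) {f : ι → Space k → ℝ}
    (hf : ∀ i ∈ s, MemAbsH H (f i)) : MemAbsH H (fun u => ∑ i ∈ s, f i u) := by
  classical
  induction s using Finset.induction_on with
  | empty => simpa using memAbsH_zero
  | insert a s ha ih =>
    simp only [Finset.sum_insert ha]
    exact (hf a (by simp)).add h2 (ih fun i hi => hf i (by simp [hi]))

/-- The bilinear form whose quadratic form is `hNormSq`. -/
noncomputable def hForm (H : Fin k → ℝ) (f g : Space k → ℝ) : ℝ :=
  ∫ q : Space k × (LongRange H → ℝ), hurstKernel H q.1 q.2 * f q.1 * g (splice H q.1 q.2)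

theorem hNormSq_eq_hForm (f : Space k → ℝ) : hNormSq H f = hForm H f f := rfl

theorem enorm_hForm_integrand (f g : Space k → ℝ) (q : Space k × (LongRange H → ℝ)) :
    ‖hurstKernel H q.1 q.2 * f q.1 * g (splice H q.1 q.2)‖ₑ =
      ENNReal.ofReal (hurstKernel H q.1 q.2) * ‖f q.1‖ₑ * ‖g (splice H q.1 q.2)‖ₑ := by
  rw [enorm_mul, enorm_mul, Real.enorm_of_nonneg (hurstKernel_nonneg _ _)]

theorem integrable_hForm (h2 : ∀ i, H i < 1) {f g : Space k → ℝ} (hf : MemAbsH H f)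
    (hg : MemAbsH H g) :
    Integrable fun q : Space k × (LongRange H → ℝ) =>
      hurstKernel H q.1 q.2 * f q.1 * g (splice H q.1 q.2) := by
  refine ⟨?_, ?_⟩
  · exact (((measurable_hurstKernel H).mul (hf.1.comp measurable_fst)).mul
      (hg.1.comp (measurable_splice H))).aestronglyMeasurable
  · rw [hasFiniteIntegral_iff_enorm]
    simp only [enorm_hForm_integrand]
    exact kerForm_lt_top_of_self h2 hf.1.enorm hg.1.enorm hf.2 hg.2

theorem hForm_eq_toReal_of_nonneg {f g : Space k → ℝ} (hf : Measurable f) (hg : Measurable g)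
    (hf0 : ∀ u, 0 ≤ f u) (hg0 : ∀ u, 0 ≤ g u) :
    hForm H f g = (kerForm H (fun u => ‖f u‖ₑ) (fun u => ‖g u‖ₑ)).toReal := by
  have hm : Measurable fun q : Space k × (LongRange H → ℝ) =>
      hurstKernel H q.1 q.2 * f q.1 * g (splice H q.1 q.2) :=
    ((measurable_hurstKernel H).mul (hf.comp measurable_fst)).mul
      (hg.comp (measurable_splice H))
  have h0 : ∀ q : Space k × (LongRange H → ℝ),
      0 ≤ hurstKernel H q.1 q.2 * f q.1 * g (splice H q.1 q.2) := fun q =>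
    mul_nonneg (mul_nonneg (hurstKernel_nonneg _ _) (hf0 _)) (hg0 _)
  rw [hForm, integral_eq_lintegral_of_nonneg_ae (Eventually.of_forall h0)
    hm.aestronglyMeasurable, kerForm]
  congr 1
  refine lintegral_congr fun q => ?_
  rw [← enorm_hForm_integrand, Real.enorm_of_nonneg (h0 q)]

theorem hForm_add_left (h2 : ∀ i, H i < 1) {f f' g : Space k → ℝ} (hf : MemAbsH H f)
    (hf' : MemAbsH H f') (hg : MemAbsH H g) :
    hForm H (fun u => f u + f' u) g = hForm H f g + hForm H f' g := by
  unfold hForm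
  rw [← integral_add (integrable_hForm h2 hf hg) (integrable_hForm h2 hf' hg)]
  exact integral_congr_ae (Eventually.of_forall fun q => by ring)

theorem hForm_add_right (h2 : ∀ i, H i < 1) {f g g' : Space k → ℝ} (hf : MemAbsH H f)
    (hg : MemAbsH H g) (hg' : MemAbsH H g') :
    hForm H f (fun u => g u + g' u) = hForm H f g + hForm H f g' := by
  unfold hForm
  rw [← integral_add (integrable_hForm h2 hf hg) (integrable_hForm h2 hf hg')]
  exact integral_congr_ae (Eventually.of_forall fun q => by ring)

theorem hForm_const_mul_left (c : ℝ) (f g : Space k → ℝ) :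
    hForm H (fun u => c * f u) g = c * hForm H f g := by
  unfold hForm
  rw [← integral_const_mul]
  exact integral_congr_ae (Eventually.of_forall fun q => by ring)

theorem hForm_const_mul_right (c : ℝ) (f g : Space k → ℝ) :
    hForm H f (fun u => c * g u) = c * hForm H f g := by
  unfold hForm
  rw [← integral_const_mul]
  exact integral_congr_ae (Eventually.of_forall fun q => by ring)

theorem hForm_neg_left (f g : Space k → ℝ) : hForm H (fun u => - f u) g = - hForm H f g := by
  simpa using hForm_const_mul_left (H := H) (-1) f g

theorem hForm_neg_right (f g : Space k → ℝ) : hForm H f (fun u => - g u) = - hForm H f g := by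
  simpa using hForm_const_mul_right (H := H) (-1) f g

theorem hForm_sum_left (h2 : ∀ i, H i < 1) {ι : Type*} (s : Finset ι) {f : ι → Space k → ℝ}
    {g : Space k → ℝ} (hf : ∀ i ∈ s, MemAbsH H (f i)) (hg : MemAbsH H g) :
    hForm H (fun u => ∑ i ∈ s, f i u) g = ∑ i ∈ s, hForm H (f i) g := by
  unfold hForm
  rw [← integral_finsetSum _ fun i hi => integrable_hForm h2 (hf i hi) hg]
  refine integral_congr_ae (Eventually.of_forall fun q => ?_)
  simp only [Finset.mul_sum, Finset.sum_mul]

theorem hForm_sum_right (h2 : ∀ i, H i < 1) {ι : Type*} (s : Finset ι) {g : ι → Space k → ℝ}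
    {f : Space k → ℝ} (hf : MemAbsH H f) (hg : ∀ i ∈ s, MemAbsH H (g i)) :
    hForm H f (fun u => ∑ i ∈ s, g i u) = ∑ i ∈ s, hForm H f (g i) := by
  unfold hForm
  rw [← integral_finsetSum _ fun i hi => integrable_hForm h2 hf (hg i hi)]
  refine integral_congr_ae (Eventually.of_forall fun q => ?_)
  simp only [Finset.mul_sum]

theorem hNormSq_add (h2 : ∀ i, H i < 1) {f g : Space k → ℝ} (hf : MemAbsH H f)
    (hg : MemAbsH H g) :
    hNormSq H (fun u => f u + g u) = hForm H f f + hForm H f g + (hForm H g f + hForm H g g) := by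
  rw [hNormSq_eq_hForm, hForm_add_left h2 hf hg (hf.add h2 hg), hForm_add_right h2 hf hf hg,
    hForm_add_right h2 hg hf hg]

theorem hNormSq_neg (f : Space k → ℝ) : hNormSq H (fun u => - f u) = hNormSq H f := by
  rw [hNormSq_eq_hForm, hForm_neg_left, hForm_neg_right, neg_neg, hNormSq_eq_hForm]

/-- The quadratic form of `|𝓗^H|` is nonnegative: with `f = f⁺ - f⁻`, the mixed terms are
controlled by the positive semidefiniteness of `kerForm` on nonnegative functions. -/
theorem hNormSq_nonneg (h2 : ∀ i, H i < 1) {f : Space k → ℝ} (hf : MemAbsH H f) :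
    0 ≤ hNormSq H f := by
  set p : Space k → ℝ := fun u => max (f u) 0 with hp
  set m : Space k → ℝ := fun u => max (-f u) 0 with hm
  have mp : Measurable p := hf.1.max measurable_const
  have mm : Measurable m := hf.1.neg.max measurable_const
  have p0 : ∀ u, 0 ≤ p u := fun u => le_max_right _ _
  have m0 : ∀ u, 0 ≤ m u := fun u => le_max_right _ _
  have hpH : MemAbsH H p := hf.mono mp fun u => by
    rw [enorm_le_iff_norm_le, Real.norm_of_nonneg (p0 u), Real.norm_eq_abs]
    exact max_le (le_abs_self _) (abs_nonneg _)
  have hmH : MemAbsH H m := hf.mono mm fun u => by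
    rw [enorm_le_iff_norm_le, Real.norm_of_nonneg (m0 u), Real.norm_eq_abs]
    exact max_le (neg_le_abs _) (abs_nonneg _)
  have hfe : f = fun u => p u + -m u := by
    ext u
    rcases le_total 0 (f u) with h | h
    · simp [hp, hm, h]
    · simp [hp, hm, h]
  have key := two_mul_kerForm_le h2 hpH.1.enorm hmH.1.enorm
  have hpp := (memAbsH_iff.1 hpH).2
  have hmm := (memAbsH_iff.1 hmH).2
  have key' := ENNReal.toReal_mono (ENNReal.add_lt_top.2 ⟨hpp, hmm⟩).ne key
  rw [ENNReal.toReal_mul, ENNReal.toReal_add hpp.ne hmm.ne] at key'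
  rw [hfe, hNormSq_add h2 hpH hmH.neg, hForm_neg_right, hForm_neg_left, hForm_neg_left,
    hForm_neg_right, hForm_eq_toReal_of_nonneg mp mp p0 p0, hForm_eq_toReal_of_nonneg mp mm p0 m0,
    hForm_eq_toReal_of_nonneg mm mp m0 p0, hForm_eq_toReal_of_nonneg mm mm m0 m0,
    kerForm_comm h2 hmH.1.enorm hpH.1.enorm]
  simp only [ENNReal.toReal_ofNat] at key'
  linarith

/-- From the parallelogram identity and the nonnegativity of the form at `f + g`. -/
theorem hNormSq_sub_le (h2 : ∀ i, H i < 1) {f g : Space k → ℝ} (hf : MemAbsH H f)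
    (hg : MemAbsH H g) :
    hNormSq H (fun u => f u - g u) ≤ 2 * hNormSq H f + 2 * hNormSq H g := by
  have h := hNormSq_nonneg h2 (hf.add h2 hg)
  rw [hNormSq_add h2 hf hg] at h
  have e := hNormSq_add h2 hf hg.neg
  rw [hForm_neg_right, hForm_neg_left, hForm_neg_left, hForm_neg_right] at e
  simp only [sub_eq_add_neg]
  rw [e, hNormSq_eq_hForm, hNormSq_eq_hForm]
  linarith

theorem hNormSq_le_toReal (f : Space k → ℝ) :
    hNormSq H f ≤ (kerForm H (fun u => ‖f u‖ₑ) (fun u => ‖f u‖ₑ)).toReal := by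
  refine (le_abs_self _).trans ?_
  have := norm_integral_le_lintegral_norm (μ := volume)
    fun q : Space k × (LongRange H → ℝ) => hurstKernel H q.1 q.2 * f q.1 * f (splice H q.1 q.2)
  simp only [ofReal_norm, enorm_hForm_integrand] at this
  exact this

end FracPoisson

namespace FracPoisson

/-! ### The one-dimensional covariance -/

theorem intervalIntegrable_abs_rpow {r : ℝ} (hr : -1 < r) (a b : ℝ) :
    IntervalIntegrable (fun x : ℝ => |x| ^ r) volume a b := by
  suffices h : ∀ c : ℝ, IntervalIntegrable (fun x : ℝ => |x| ^ r) volume 0 c from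
    (h a).symm.trans (h b)
  have hpos : ∀ c : ℝ, 0 ≤ c → IntervalIntegrable (fun x : ℝ => |x| ^ r) volume 0 c := by
    intro c hc
    refine (intervalIntegral.intervalIntegrable_rpow' hr).congr_ae ?_
    rw [uIoc_of_le hc]
    filter_upwards [ae_restrict_mem measurableSet_Ioc] with x hx
    rw [abs_of_pos hx.1]
  intro c
  rcases le_total 0 c with hc | hc
  · exact hpos c hc
  · rw [IntervalIntegrable.iff_comp_neg, neg_zero]
    simpa only [abs_neg] using hpos (-c) (by linarith)

/-- The function on the right is the derivative of `|x|^p`, which is continuously differentiable. -/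
theorem continuous_abs_rpow_sub_two_mul {p : ℝ} (hp : 1 < p) :
    Continuous fun x : ℝ => p * |x| ^ (p - 2) * x := by
  have h := (contDiff_norm_rpow (E := ℝ) hp).continuous_deriv le_rfl
  have e : (deriv fun x : ℝ => ‖x‖ ^ p) = fun x : ℝ => p * |x| ^ (p - 2) * x :=
    funext fun x => (hasDerivAt_abs_rpow x hp).deriv
  rwa [e] at h

/-- The derivative of `½|x|^{2h}`. -/
noncomputable def halfDeriv (h x : ℝ) : ℝ := 1 / 2 * (2 * h * |x| ^ (2 * h - 2) * x)

theorem continuous_halfDeriv {h : ℝ} (h1 : 1 / 2 < h) : Continuous (halfDeriv h) :=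
  continuous_const.mul (continuous_abs_rpow_sub_two_mul (by linarith))

theorem hasDerivAt_halfDeriv {h x : ℝ} (hx : x ≠ 0) :
    HasDerivAt (halfDeriv h) (h * (2 * h - 1) * |x| ^ (2 * h - 2)) x := by
  have key : ∀ x : ℝ, 0 < x →
      HasDerivAt (halfDeriv h) (h * (2 * h - 1) * |x| ^ (2 * h - 2)) x := by
    intro x hx
    have h0 := ((Real.hasDerivAt_rpow_const (x := x) (p := 2 * h - 1) (Or.inl hx.ne')).const_mul h)
    have e : halfDeriv h =ᶠ[𝓝 x] fun y => h * y ^ (2 * h - 1) := by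
      filter_upwards [lt_mem_nhds hx] with y hy
      have : y ^ (2 * h - 1) = y ^ (2 * h - 2) * y := by
        rw [← Real.rpow_add_one hy.ne']; congr 1; ring
      rw [halfDeriv, abs_of_pos hy, this]; ring
    refine (h0.congr_of_eventuallyEq e).congr_deriv ?_
    rw [abs_of_pos hx, show 2 * h - 1 - 1 = 2 * h - 2 by ring]; ring
  rcases lt_or_gt_of_ne hx with hx | hx
  · have h0 := (key (-x) (by linarith)).scomp x (hasDerivAt_neg x)
    have e : halfDeriv h = fun y => -(halfDeriv h ∘ Neg.neg) y := by
      ext y; simp [halfDeriv]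
    rw [e]
    refine h0.fun_neg.congr_deriv ?_
    simp
  · exact key x hx

theorem intervalIntegrable_kernel {h : ℝ} (h1 : 1 / 2 < h) (s c d : ℝ) :
    IntervalIntegrable (fun t => h * (2 * h - 1) * |s - t| ^ (2 * h - 2)) volume c d := by
  have := (intervalIntegrable_abs_rpow (by linarith : -1 < 2 * h - 2)
    (c - s) (d - s)).comp_sub_right s
  simp only [sub_add_cancel, abs_sub_comm _ s] at this
  exact this.const_mul _

/-- The singularity at `t = s` is harmless: the antiderivative is continuous there. -/
theorem integral_kernel {h : ℝ} (h1 : 1 / 2 < h) (s c d : ℝ) :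
    ∫ t in c..d, h * (2 * h - 1) * |s - t| ^ (2 * h - 2) =
      halfDeriv h (d - s) - halfDeriv h (c - s) := by
  refine MeasureTheory.integral_eq_of_hasDerivAt_off_countable (fun t => halfDeriv h (t - s)) _
    (countable_singleton s) ?_ ?_ (intervalIntegrable_kernel h1 s c d)
  · exact ((continuous_halfDeriv h1).comp (continuous_id.sub continuous_const)).continuousOn
  · intro t ht
    have hts : t - s ≠ 0 := sub_ne_zero.2 (by simpa using ht.2)
    have := (hasDerivAt_halfDeriv (h := h) hts).comp_sub_const t s
    rwa [abs_sub_comm] at this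

theorem lintegral_Icc_eq_ofReal {f : ℝ → ℝ} {a b : ℝ} (hab : a ≤ b)
    (hf : IntervalIntegrable f volume a b) (h0 : ∀ x, 0 ≤ f x) :
    ∫⁻ x in Icc a b, ENNReal.ofReal (f x) = ENNReal.ofReal (∫ x in a..b, f x) := by
  rw [intervalIntegral.integral_of_le hab, ← integral_Icc_eq_integral_Ioc,
    ofReal_integral_eq_lintegral_ofReal]
  · rwa [← IntegrableOn, integrableOn_Icc_iff_integrableOn_Ioc,
      ← intervalIntegrable_iff_integrableOn_Ioc_of_le hab]
  · exact Eventually.of_forall h0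

/-- The covariance of the increments over `[a, b]` and `[c, d]` of a fractional Brownian motion. -/
noncomputable def incrCov (h a b c d : ℝ) : ℝ :=
  1 / 2 * (|b - c| ^ (2 * h) + |a - d| ^ (2 * h) - |b - d| ^ (2 * h) - |a - c| ^ (2 * h))

theorem incrCov_eq_fbmCov (h a b c d : ℝ) :
    incrCov h a b c d = fbmCov h b d - fbmCov h b c - fbmCov h a d + fbmCov h a c := by
  unfold incrCov fbmCov; ring

theorem continuous_halfDeriv_sub {h : ℝ} (h1 : 1 / 2 < h) (e : ℝ) :
    Continuous fun s => halfDeriv h (e - s) :=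
  (continuous_halfDeriv h1).comp (continuous_const.sub continuous_id)

theorem integral_halfDeriv_sub {h : ℝ} (h1 : 1 / 2 < h) (a b e : ℝ) :
    ∫ s in a..b, halfDeriv h (e - s) =
      1 / 2 * |a - e| ^ (2 * h) - 1 / 2 * |b - e| ^ (2 * h) := by
  have := intervalIntegral.integral_eq_sub_of_hasDerivAt
    (f := fun s => -(1 / 2 * |e - s| ^ (2 * h))) (f' := fun s => halfDeriv h (e - s))
    (a := a) (b := b) ?_ ((continuous_halfDeriv_sub h1 e).intervalIntegrable _ _)
  · rw [this, abs_sub_comm e b, abs_sub_comm e a]; ring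
  · intro s _
    have h0 := ((hasDerivAt_abs_rpow (e - s) (by linarith : 1 < 2 * h)).const_mul
      (1 / 2)).scomp s ((hasDerivAt_id s).const_sub e)
    refine h0.fun_neg.congr_deriv ?_
    simp only [halfDeriv, smul_eq_mul]; ring

theorem integral_halfDeriv_sub_sub {h : ℝ} (h1 : 1 / 2 < h) (a b c d : ℝ) :
    ∫ s in a..b, (halfDeriv h (d - s) - halfDeriv h (c - s)) = incrCov h a b c d := by
  rw [intervalIntegral.integral_sub ((continuous_halfDeriv_sub h1 d).intervalIntegrable _ _)
    ((continuous_halfDeriv_sub h1 c).intervalIntegrable _ _), integral_halfDeriv_sub h1,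
    integral_halfDeriv_sub h1]
  unfold incrCov; ring

theorem kernel_nonneg {h : ℝ} (h1 : 1 / 2 < h) (s t : ℝ) :
    0 ≤ h * (2 * h - 1) * |s - t| ^ (2 * h - 2) :=
  mul_nonneg (mul_nonneg (by linarith) (by linarith)) (by positivity)

theorem halfDeriv_sub_nonneg {h c d : ℝ} (h1 : 1 / 2 < h) (hcd : c ≤ d) (s : ℝ) :
    0 ≤ halfDeriv h (d - s) - halfDeriv h (c - s) := by
  rw [← integral_kernel h1]
  exact intervalIntegral.integral_nonneg hcd fun t _ => kernel_nonneg h1 s t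

theorem lintegral_lintegral_kernel1 {h a b c d : ℝ} (h1 : 1 / 2 < h) (hab : a ≤ b) (hcd : c ≤ d) :
    ∫⁻ s in Icc a b, ∫⁻ t in Icc c d, kernel1 h s t = ENNReal.ofReal (incrCov h a b c d) := by
  have inner : ∀ s, ∫⁻ t in Icc c d, kernel1 h s t =
      ENNReal.ofReal (halfDeriv h (d - s) - halfDeriv h (c - s)) := by
    intro s
    rw [← integral_kernel h1, ← lintegral_Icc_eq_ofReal hcd (intervalIntegrable_kernel h1 s c d)
      (kernel_nonneg h1 s)]
    rfl
  simp only [inner]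
  have hsub : Continuous fun s => halfDeriv h (d - s) - halfDeriv h (c - s) :=
    (continuous_halfDeriv_sub h1 d).sub (continuous_halfDeriv_sub h1 c)
  rw [lintegral_Icc_eq_ofReal hab (hsub.intervalIntegrable _ _) (halfDeriv_sub_nonneg h1 hcd),
    integral_halfDeriv_sub_sub h1]

theorem incrCov_half {a b c d : ℝ} (hab : a ≤ b) (hcd : c ≤ d) :
    incrCov (1 / 2) a b c d = max (min b d - max a c) 0 := by
  simp only [incrCov, mul_one_div, div_self (two_ne_zero' ℝ), Real.rpow_one]
  grind

theorem incrCov_nonneg {h a b c d : ℝ} (h1 : 1 / 2 ≤ h) (hab : a ≤ b) (hcd : c ≤ d) :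
    0 ≤ incrCov h a b c d := by
  rcases h1.eq_or_lt with rfl | h1
  · rw [incrCov_half hab hcd]; exact le_max_right _ _
  · rw [← integral_halfDeriv_sub_sub h1]
    exact intervalIntegral.integral_nonneg hab fun s _ => halfDeriv_sub_nonneg h1 hcd s

/-- The one-dimensional form of two intervals is the covariance of the increments over them, for
`h > 1/2` by integrating the kernel twice, for `h = 1/2` as the length of the intersection. -/
theorem kerForm1_indicator_Icc {h a b c d : ℝ} (h1 : 1 / 2 ≤ h) (hab : a ≤ b) (hcd : c ≤ d) :
    kerForm1 h ((Icc a b).indicator fun _ => 1) ((Icc c d).indicator fun _ => 1) =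
      ENNReal.ofReal (incrCov h a b c d) := by
  unfold kerForm1
  split_ifs with hh
  · rw [← lintegral_lintegral_kernel1 hh hab hcd, ← lintegral_indicator measurableSet_Icc]
    refine lintegral_congr fun s => ?_
    by_cases hs : s ∈ Icc a b
    · rw [indicator_of_mem hs, indicator_of_mem hs, ← lintegral_indicator measurableSet_Icc]
      refine lintegral_congr fun t => ?_
      by_cases ht : t ∈ Icc c d <;> simp [ht]
    · simp [hs]
  · have e : h = 1 / 2 := le_antisymm (not_lt.1 hh) h1
    have e2 : ∀ s, (Icc a b).indicator (fun _ => (1 : ℝ≥0∞)) s *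
        (Icc c d).indicator (fun _ => (1 : ℝ≥0∞)) s =
        (Icc a b ∩ Icc c d).indicator (fun _ => 1) s := fun s => by
      rw [show (fun _ : ℝ => (1 : ℝ≥0∞)) = fun _ => 1 * 1 by simp, Set.inter_indicator_mul]
      simp
    simp only [e2]
    rw [lintegral_indicator (measurableSet_Icc.inter measurableSet_Icc), setLIntegral_const,
      one_mul, Icc_inter_Icc, Real.volume_Icc, e, incrCov_half hab hcd, ENNReal.ofReal_max,
      ENNReal.ofReal_zero, max_eq_left zero_le]

end FracPoisson

namespace FracPoisson

variable {k : ℕ} {H : Fin k → ℝ}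

/-! ### The isometry on elementary functions -/

/-- The indicator function of the rectangle `[a, b]`. -/
noncomputable def boxInd (a b : Space k) : Space k → ℝ := (box a b).indicator fun _ => 1

theorem measurableSet_box (a b : Space k) : MeasurableSet (box a b) := by
  have : box a b = ⋂ i, {η : Space k | a i ≤ η i} ∩ {η | η i ≤ b i} := by
    ext η; simp [box]
  rw [this]
  exact MeasurableSet.iInter fun i =>
    (measurableSet_le (f := fun _ : Space k => a i) (g := fun η => η i) (by fun_prop)
      (by fun_prop)).inter (measurableSet_le (f := fun η : Space k => η i) (g := fun _ => b i)
        (by fun_prop) (by fun_prop))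

theorem measurable_boxInd (a b : Space k) : Measurable (boxInd a b) :=
  measurable_const.indicator (measurableSet_box a b)

theorem boxInd_nonneg (a b : Space k) (u : Space k) : 0 ≤ boxInd a b u :=
  indicator_nonneg (fun _ _ => zero_le_one) u

theorem enorm_boxInd (a b u : Space k) :
    ‖boxInd a b u‖ₑ = ∏ i, (Icc (a i) (b i)).indicator (fun _ => (1 : ℝ≥0∞)) (u i) := by
  by_cases hu : u ∈ box a b
  · rw [boxInd, indicator_of_mem hu, Finset.prod_eq_one fun i _ =>
      indicator_of_mem (s := Icc (a i) (b i)) (hu i) _]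
    simp
  · rw [boxInd, indicator_of_notMem hu]
    simp only [box, mem_ofPred_eq, not_forall] at hu
    obtain ⟨i, hi⟩ := hu
    rw [Finset.prod_eq_zero (Finset.mem_univ i) (indicator_of_notMem (s := Icc (a i) (b i)) hi _)]
    simp

theorem kerForm_boxInd (h1 : ∀ i, 1 / 2 ≤ H i) {a b c d : Space k} (hab : ∀ i, a i ≤ b i)
    (hcd : ∀ i, c i ≤ d i) :
    kerForm H (fun u => ‖boxInd a b u‖ₑ) (fun u => ‖boxInd c d u‖ₑ) =
      ENNReal.ofReal (∏ i, incrCov (H i) (a i) (b i) (c i) (d i)) := by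
  simp only [enorm_boxInd]
  rw [kerForm_prod H (fun i => measurable_const.indicator measurableSet_Icc)
    (fun i => measurable_const.indicator measurableSet_Icc),
    ENNReal.ofReal_prod_of_nonneg fun i _ => incrCov_nonneg (h1 i) (hab i) (hcd i)]
  exact Finset.prod_congr rfl fun i _ => kerForm1_indicator_Icc (h1 i) (hab i) (hcd i)

theorem memAbsH_boxInd (h1 : ∀ i, 1 / 2 ≤ H i) {a b : Space k} (hab : ∀ i, a i ≤ b i) :
    MemAbsH H (boxInd a b) := by
  rw [memAbsH_iff]
  refine ⟨measurable_boxInd a b, ?_⟩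
  rw [kerForm_boxInd h1 hab hab]
  exact ENNReal.ofReal_lt_top

theorem hForm_boxInd (h1 : ∀ i, 1 / 2 ≤ H i) {a b c d : Space k} (hab : ∀ i, a i ≤ b i)
    (hcd : ∀ i, c i ≤ d i) :
    hForm H (boxInd a b) (boxInd c d) = ∏ i, incrCov (H i) (a i) (b i) (c i) (d i) := by
  rw [hForm_eq_toReal_of_nonneg (measurable_boxInd a b) (measurable_boxInd c d)
    (boxInd_nonneg a b) (boxInd_nonneg c d), kerForm_boxInd h1 hab hcd, ENNReal.toReal_ofReal]
  exact Finset.prod_nonneg fun i _ => incrCov_nonneg (h1 i) (hab i) (hcd i)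

theorem Elementary.toFun_eq (e : Elementary k) :
    e.toFun = fun u => ∑ l, e.coeff l * boxInd (e.lo l) (e.hi l) u := rfl

theorem memAbsH_elementary (h1 : ∀ i, 1 / 2 ≤ H i) (h2 : ∀ i, H i < 1) (e : Elementary k) :
    MemAbsH H e.toFun := by
  rw [e.toFun_eq]
  exact MemAbsH.sum h2 _ fun l _ => (memAbsH_boxInd h1 (e.lo_le_hi l)).const_mul _

theorem hNormSq_elementary (h1 : ∀ i, 1 / 2 ≤ H i) (h2 : ∀ i, H i < 1) (e : Elementary k) :
    hNormSq H e.toFun = ∑ l, ∑ m, e.coeff l * (e.coeff m *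
      ∏ i, incrCov (H i) (e.lo l i) (e.hi l i) (e.lo m i) (e.hi m i)) := by
  have hm : ∀ l ∈ Finset.univ, MemAbsH H fun u => e.coeff l * boxInd (e.lo l) (e.hi l) u :=
    fun l _ => (memAbsH_boxInd h1 (e.lo_le_hi l)).const_mul _
  rw [hNormSq_eq_hForm, e.toFun_eq, hForm_sum_left h2 _ hm (MemAbsH.sum h2 _ hm)]
  refine Finset.sum_congr rfl fun l _ => ?_
  rw [hForm_sum_right h2 _ (hm l (Finset.mem_univ l)) hm]
  refine Finset.sum_congr rfl fun m _ => ?_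
  rw [hForm_const_mul_left, hForm_const_mul_right, hForm_boxInd h1 (e.lo_le_hi l) (e.lo_le_hi m)]

/-- The alternating sum over the vertices of a rectangle of a product function. -/
theorem sum_neg_one_pow_mul_prod (φ : Fin k → ℝ → ℝ) (a b : Fin k → ℝ) :
    ∑ s : Finset (Fin k), (-1 : ℝ) ^ s.card * ∏ i, φ i (if i ∈ s then a i else b i) =
      ∏ i, (φ i (b i) - φ i (a i)) := by
  classical
  rw [Finset.prod_sub, Finset.powerset_univ]
  refine Finset.sum_congr rfl fun s _ => ?_
  rw [mul_assoc, ← Finset.prod_sdiff (Finset.subset_univ s)]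
  congr 2
  · exact Finset.prod_congr rfl fun i hi => by rw [if_neg (Finset.mem_sdiff.1 hi).2]
  · exact Finset.prod_congr rfl fun i hi => by rw [if_pos hi]

section Field

variable {Ω : Type*} [MeasurableSpace Ω] {P : Measure Ω} {B : Space k → Ω → ℝ}

theorem memLp_rectIncrement (hB : IsFractionalBrownianField H B P) (a b : Space k) :
    MemLp (rectIncrement B a b) 2 P := by
  unfold rectIncrement
  exact memLp_finsetSum _ fun s _ =>
    ((hB.isGaussian.hasGaussianLaw_eval _).memLp_two).const_mul _

theorem memLp_integral (hB : IsFractionalBrownianField H B P) (e : Elementary k) :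
    MemLp (e.integral B) 2 P := by
  unfold Elementary.integral
  exact memLp_finsetSum _ fun l _ => (memLp_rectIncrement hB _ _).const_mul _

/-- The covariance of rectangular increments is a product, since the covariance of the field is. -/
theorem integral_rectIncrement_mul (hB : IsFractionalBrownianField H B P) (a b c d : Space k) :
    ∫ ω, rectIncrement B a b ω * rectIncrement B c d ω ∂P =
      ∏ i, incrCov (H i) (a i) (b i) (c i) (d i) := by
  have hint : ∀ x y, Integrable (fun ω => B x ω * B y ω) P := fun x y =>
    MemLp.integrable_mul (p := 2) (q := 2) (hB.isGaussian.hasGaussianLaw_eval x).memLp_two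
      (hB.isGaussian.hasGaussianLaw_eval y).memLp_two
  simp only [rectIncrement, Finset.sum_mul_sum]
  have e : ∀ (r r' x y : ℝ), r * x * (r' * y) = r * (r' * (x * y)) := fun r r' x y => by ring
  simp only [e]
  rw [integral_finsetSum _ fun t _ => integrable_finsetSum _ fun s _ =>
    ((hint _ _).const_mul _).const_mul _]
  have inner : ∀ t : Finset (Fin k), ∫ ω, ∑ s : Finset (Fin k), (-1 : ℝ) ^ t.card *
      ((-1 : ℝ) ^ s.card * (B (WithLp.toLp 2 fun i => if i ∈ t then a i else b i) ω *
        B (WithLp.toLp 2 fun i => if i ∈ s then c i else d i) ω)) ∂P =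
      (-1 : ℝ) ^ t.card * ∏ i, (fun x => fbmCov (H i) x (d i) - fbmCov (H i) x (c i))
        (if i ∈ t then a i else b i) := by
    intro t
    rw [integral_finsetSum _ fun s _ => ((hint _ _).const_mul _).const_mul _]
    simp only [integral_const_mul, hB.covariance, ← Finset.mul_sum]
    congr 1
    exact sum_neg_one_pow_mul_prod
      (fun i y => fbmCov (H i) (if i ∈ t then a i else b i) y) c d
  simp only [inner]
  rw [sum_neg_one_pow_mul_prod (fun i x => fbmCov (H i) x (d i) - fbmCov (H i) x (c i)) a b]
  refine Finset.prod_congr rfl fun i _ => ?_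
  rw [incrCov_eq_fbmCov]; ring

/-- The integral of elementary functions is an isometry. -/
theorem integral_elementary_sq (h1 : ∀ i, 1 / 2 ≤ H i) (h2 : ∀ i, H i < 1)
    (hB : IsFractionalBrownianField H B P) (e : Elementary k) :
    ∫ ω, e.integral B ω ^ 2 ∂P = hNormSq H e.toFun := by
  have hint : ∀ l m, Integrable (fun ω => rectIncrement B (e.lo l) (e.hi l) ω *
      rectIncrement B (e.lo m) (e.hi m) ω) P := fun l m =>
    MemLp.integrable_mul (p := 2) (q := 2) (memLp_rectIncrement hB _ _)
      (memLp_rectIncrement hB _ _)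
  rw [hNormSq_elementary h1 h2]
  simp only [Elementary.integral, pow_two, Finset.sum_mul_sum]
  have e1 : ∀ (r r' x y : ℝ), r * x * (r' * y) = r * (r' * (x * y)) := fun r r' x y => by ring
  simp only [e1]
  rw [integral_finsetSum _ fun t _ => integrable_finsetSum _ fun s _ =>
    ((hint _ _).const_mul _).const_mul _]
  refine Finset.sum_congr rfl fun l _ => ?_
  rw [integral_finsetSum _ fun s _ => ((hint _ _).const_mul _).const_mul _]
  refine Finset.sum_congr rfl fun m _ => ?_
  rw [integral_const_mul, integral_const_mul, integral_rectIncrement_mul hB]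

end Field

/-! ### Algebra of elementary functions -/

namespace Elementary

/-- The elementary function `e + c e'`. -/
noncomputable def addMul (e : Elementary k) (c : ℝ) (e' : Elementary k) : Elementary k where
  num := e.num + e'.num
  coeff := Fin.append e.coeff fun l => c * e'.coeff l
  lo := Fin.append e.lo e'.lo
  hi := Fin.append e.hi e'.hi
  lo_le_hi l i := by
    induction l using Fin.addCases with
    | left l => simpa using e.lo_le_hi l i
    | right l => simpa using e'.lo_le_hi l i

theorem toFun_addMul (e : Elementary k) (c : ℝ) (e' : Elementary k) (u : Space k) :
    (e.addMul c e').toFun u = e.toFun u + c * e'.toFun u := by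
  refine (Fin.sum_univ_add (a := e.num) (b := e'.num) _).trans ?_
  simp only [toFun, addMul, Fin.append_left, Fin.append_right, Finset.mul_sum, mul_assoc]

theorem integral_addMul {Ω : Type*} (B : Space k → Ω → ℝ) (e : Elementary k) (c : ℝ)
    (e' : Elementary k) (ω : Ω) :
    (e.addMul c e').integral B ω = e.integral B ω + c * e'.integral B ω := by
  refine (Fin.sum_univ_add (a := e.num) (b := e'.num) _).trans ?_
  simp only [integral, addMul, Fin.append_left, Fin.append_right, Finset.mul_sum, mul_assoc]

/-- The zero elementary function. -/
def zero : Elementary k where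
  num := 0
  coeff := Fin.elim0
  lo := Fin.elim0
  hi := Fin.elim0
  lo_le_hi l := l.elim0

theorem toFun_zero (u : Space k) : (zero : Elementary k).toFun u = 0 := by
  exact Fin.sum_univ_zero _

/-- The indicator of a rectangle as an elementary function. -/
noncomputable def single (a b : Space k) (hab : ∀ i, a i ≤ b i) : Elementary k where
  num := 1
  coeff _ := 1
  lo _ := a
  hi _ := b
  lo_le_hi _ := hab

theorem toFun_single (a b : Space k) (hab : ∀ i, a i ≤ b i) (u : Space k) :
    (single a b hab).toFun u = boxInd a b u := by
  exact (Fin.sum_univ_one _).trans (one_mul _)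

end Elementary

end FracPoisson

namespace FracPoisson

variable {k : ℕ} {H : Fin k → ℝ}

/-! ### Density of elementary functions -/

/-- The squared norm of `|𝓗^H|`. -/
noncomputable def absNormSq (H : Fin k → ℝ) (f : Space k → ℝ) : ℝ≥0∞ :=
  kerForm H (fun u => ‖f u‖ₑ) (fun u => ‖f u‖ₑ)

theorem absNormSq_add_le (h2 : ∀ i, H i < 1) {f g : Space k → ℝ} (hf : Measurable f)
    (hg : Measurable g) :
    absNormSq H (fun u => f u + g u) ≤ 2 * absNormSq H f + 2 * absNormSq H g := by
  have mf := hf.enorm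
  have mg := hg.enorm
  have hle : ∀ u, ‖f u + g u‖ₑ ≤ ‖f u‖ₑ + ‖g u‖ₑ := fun u => enorm_add_le _ _
  refine (kerForm_mono hle hle).trans ?_
  have mfg : Measurable fun u => ‖f u‖ₑ + ‖g u‖ₑ := mf.add mg
  rw [kerForm_add_left mf mfg, kerForm_add_right mf mf, kerForm_add_right mg mf,
    kerForm_comm h2 mg mf]
  have key := two_mul_kerForm_le h2 mf mg
  unfold absNormSq
  calc _ = kerForm H (fun u => ‖f u‖ₑ) (fun u => ‖f u‖ₑ) +
        kerForm H (fun u => ‖g u‖ₑ) (fun u => ‖g u‖ₑ) +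
        2 * kerForm H (fun u => ‖f u‖ₑ) (fun u => ‖g u‖ₑ) := by ring
    _ ≤ _ := add_le_add_right key _
    _ = _ := by ring

theorem absNormSq_const_mul (c : ℝ) {f : Space k → ℝ} (hf : Measurable f) :
    absNormSq H (fun u => c * f u) = ‖c‖ₑ * ‖c‖ₑ * absNormSq H f := by
  rw [absNormSq, absNormSq, kerForm, kerForm,
    ← lintegral_const_mul _ (measurable_kerForm_integrand H hf.enorm hf.enorm)]
  refine lintegral_congr fun q => ?_
  rw [enorm_mul, enorm_mul]; ring

/-- Dominated convergence in `|𝓗^H|`. -/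
theorem tendsto_absNormSq_zero {g : ℕ → Space k → ℝ} {G : Space k → ℝ} (hG : MemAbsH H G)
    (hg : ∀ n, Measurable (g n)) (hle : ∀ n u, ‖g n u‖ₑ ≤ ‖G u‖ₑ)
    (hlim : ∀ u, Tendsto (fun n => g n u) atTop (𝓝 0)) :
    Tendsto (fun n => absNormSq H (g n)) atTop (𝓝 0) := by
  have h0 : ∫⁻ _ : Space k × (LongRange H → ℝ), (0 : ℝ≥0∞) = 0 := by simp
  rw [← h0]
  refine tendsto_lintegral_of_dominated_convergence
    (fun q => ENNReal.ofReal (hurstKernel H q.1 q.2) * ‖G q.1‖ₑ * ‖G (splice H q.1 q.2)‖ₑ)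
    (fun n => measurable_kerForm_integrand H (hg n).enorm (hg n).enorm)
    (fun n => Eventually.of_forall fun q =>
      mul_le_mul' (mul_le_mul' le_rfl (hle n _)) (hle n _)) hG.2.ne
    (Eventually.of_forall fun q => ?_)
  have e : ∀ u, Tendsto (fun n => ‖g n u‖ₑ) atTop (𝓝 0) := fun u => by
    simpa using (hlim u).enorm
  have := ENNReal.Tendsto.mul (ENNReal.Tendsto.const_mul
    (a := ENNReal.ofReal (hurstKernel H q.1 q.2)) (e q.1) (Or.inr ENNReal.ofReal_ne_top))
    (Or.inr (by simp)) (e (splice H q.1 q.2)) (Or.inr (by simp))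
  simpa using this

/-- The measurable functions that elementary functions approximate arbitrarily well in the norm of
`|𝓗^H|`. -/
def IsApproximable (H : Fin k → ℝ) (f : Space k → ℝ) : Prop :=
  Measurable f ∧ ∀ ε : ℝ≥0∞, 0 < ε → ∃ e : Elementary k, absNormSq H (fun u => e.toFun u - f u) ≤ ε

theorem measurable_toFun (e : Elementary k) : Measurable e.toFun := by
  rw [e.toFun_eq]
  exact Finset.measurable_fun_sum _ fun l _ => (measurable_boxInd _ _).const_mul _

theorem isApproximable_toFun (e : Elementary k) : IsApproximable H e.toFun :=
  ⟨measurable_toFun e, fun ε _ => ⟨e, by simp [absNormSq, kerForm]⟩⟩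

theorem IsApproximable.addMul (h2 : ∀ i, H i < 1) {f g : Space k → ℝ} (hf : IsApproximable H f)
    (c : ℝ) (hg : IsApproximable H g) : IsApproximable H (fun u => f u + c * g u) := by
  refine ⟨hf.1.add (hg.1.const_mul c), fun ε hε => ?_⟩
  set C : ℝ≥0∞ := 1 + ‖c‖ₑ * ‖c‖ₑ with hC
  have hC0 : C ≠ 0 := by simp [hC]
  have hCt : C ≠ ∞ := by simp [hC, ENNReal.mul_eq_top]
  have hδ : 0 < ε / (4 * C) := ENNReal.div_pos hε.ne' (by
    exact ENNReal.mul_ne_top (by simp) hCt)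
  obtain ⟨e, he⟩ := hf.2 _ hδ
  obtain ⟨e', he'⟩ := hg.2 _ hδ
  refine ⟨e.addMul c e', ?_⟩
  have e1 : (fun u => (e.addMul c e').toFun u - (f u + c * g u)) =
      fun u => (e.toFun u - f u) + c * (e'.toFun u - g u) := by
    ext u; rw [Elementary.toFun_addMul]; ring
  have m1 : Measurable fun u => e.toFun u - f u := (measurable_toFun e).sub hf.1
  have m2 : Measurable fun u => e'.toFun u - g u := (measurable_toFun e').sub hg.1
  rw [e1]
  refine (absNormSq_add_le h2 m1 (m2.const_mul c)).trans ?_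
  rw [absNormSq_const_mul c m2]
  calc 2 * absNormSq H (fun u => e.toFun u - f u) +
        2 * (‖c‖ₑ * ‖c‖ₑ * absNormSq H fun u => e'.toFun u - g u)
      ≤ 2 * (C * (ε / (4 * C))) + 2 * (C * (ε / (4 * C))) := by
        gcongr
        · exact he.trans (le_mul_of_one_le_left zero_le le_self_add)
        · exact le_add_self
    _ = 4 * C * (ε / (4 * C)) := by ring
    _ ≤ ε := ENNReal.mul_div_le

theorem isApproximable_zero : IsApproximable H fun _ : Space k => 0 := by
  have h := isApproximable_toFun (H := H) (Elementary.zero (k := k))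
  rwa [show (Elementary.zero (k := k)).toFun = fun _ => 0 from funext Elementary.toFun_zero] at h

theorem IsApproximable.sum (h2 : ∀ i, H i < 1) {ι : Type*} (s : Finset ι) (c : ι → ℝ)
    {f : ι → Space k → ℝ} (hf : ∀ i ∈ s, IsApproximable H (f i)) :
    IsApproximable H (fun u => ∑ i ∈ s, c i * f i u) := by
  classical
  induction s using Finset.induction_on with
  | empty => simpa using isApproximable_zero
  | insert a s ha ih =>
    simp only [Finset.sum_insert ha, add_comm (c a * _)]
    exact (ih fun i hi => hf i (by simp [hi])).addMul h2 _ (hf a (by simp))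

theorem IsApproximable.of_tendsto (h2 : ∀ i, H i < 1) {f : ℕ → Space k → ℝ} {g : Space k → ℝ}
    (hg : Measurable g) (hf : ∀ n, IsApproximable H (f n))
    (hlim : Tendsto (fun n => absNormSq H fun u => f n u - g u) atTop (𝓝 0)) :
    IsApproximable H g := by
  refine ⟨hg, fun ε hε => ?_⟩
  have hδ : 0 < ε / 4 := ENNReal.div_pos hε.ne' (by simp)
  obtain ⟨n, hn⟩ := (hlim.eventually (ge_mem_nhds hδ)).exists
  obtain ⟨e, he⟩ := (hf n).2 _ hδ
  refine ⟨e, ?_⟩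
  have e1 : (fun u => e.toFun u - g u) = fun u => (e.toFun u - f n u) + (f n u - g u) := by
    ext u; ring
  rw [e1]
  refine (absNormSq_add_le h2 ((measurable_toFun e).sub (hf n).1) ((hf n).1.sub hg)).trans ?_
  calc _ ≤ 2 * (ε / 4) + 2 * (ε / 4) :=
        add_le_add (mul_le_mul' le_rfl he) (mul_le_mul' le_rfl hn)
    _ = 4 * (ε / 4) := by ring
    _ ≤ ε := ENNReal.mul_div_le

/-- The cube `[-N, N]^k`. -/
def cube (k N : ℕ) : Set (Space k) :=
  box (WithLp.toLp 2 fun _ => -(N : ℝ)) (WithLp.toLp 2 fun _ => (N : ℝ))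

theorem isApproximable_boxInd {a b : Space k} (hab : ∀ i, a i ≤ b i) :
    IsApproximable H (boxInd a b) := by
  have h := isApproximable_toFun (H := H) (Elementary.single a b hab)
  rwa [show (Elementary.single a b hab).toFun = boxInd a b from
    funext (Elementary.toFun_single a b hab)] at h

theorem isApproximable_indicator_cube (N : ℕ) :
    IsApproximable H ((cube k N).indicator fun _ => 1) :=
  isApproximable_boxInd fun i => by simp

theorem memAbsH_indicator_cube (h1 : ∀ i, 1 / 2 ≤ H i) (N : ℕ) :
    MemAbsH H ((cube k N).indicator fun _ => 1) :=
  memAbsH_boxInd h1 fun i => by simp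

/-- The sets in question are rectangles or empty; they generate the measurable subsets of the cube.
-/
theorem isApproximable_indicator_Iic_inter_cube (N : ℕ) (a : Fin k → ℝ) :
    IsApproximable H
      (({u : Space k | ∀ i, u i ≤ a i} ∩ cube k N).indicator fun _ => (1 : ℝ)) := by
  by_cases h : ∀ i, -(N : ℝ) ≤ a i
  · have e : {u : Space k | ∀ i, u i ≤ a i} ∩ cube k N =
        box (WithLp.toLp 2 fun _ => -(N : ℝ)) (WithLp.toLp 2 fun i => min (a i) N) := by
      ext u
      simp only [cube, box, mem_inter_iff, mem_ofPred_eq, le_min_iff]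
      grind
    rw [e]
    exact isApproximable_boxInd fun i => le_min (h i) (by simp)
  · push Not at h
    obtain ⟨i, hi⟩ := h
    have e : {u : Space k | ∀ i, u i ≤ a i} ∩ cube k N = ∅ := by
      ext u
      simp only [cube, box, mem_inter_iff, mem_ofPred_eq, mem_empty_iff_false, iff_false, not_and]
      intro hu hu'
      linarith [hu i, (hu' i).1]
    rw [e]
    simpa using isApproximable_zero

theorem isCountablySpanning_range_Iic : IsCountablySpanning (range Iic : Set (Set ℝ)) :=
  ⟨fun n : ℕ => Iic (n : ℝ), fun n => mem_range_self _, by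
    ext x; simpa using exists_nat_ge x⟩

/-- Indicators of bounded measurable sets are approximable, by Dynkin's theorem. The intersection
with a cube keeps all functions in `|𝓗^H|` and provides the dominating function for disjoint unions.
-/
theorem isApproximable_indicator_inter_cube (h1 : ∀ i, 1 / 2 ≤ H i) (h2 : ∀ i, H i < 1) (N : ℕ)
    {A : Set (Space k)} (hA : MeasurableSet A) :
    IsApproximable H ((A ∩ cube k N).indicator fun _ => (1 : ℝ)) := by
  have hcube : MeasurableSet (cube k N) := measurableSet_box _ _
  suffices h : ∀ A : Set (Fin k → ℝ), MeasurableSet A →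
      IsApproximable H (((WithLp.ofLp (p := 2) ⁻¹' A) ∩ cube k N).indicator fun _ => (1 : ℝ)) by
    have h' := h (WithLp.toLp 2 ⁻¹' A) (WithLp.measurable_toLp 2 _ hA)
    rwa [← preimage_comp] at h'
  have hgen : (MeasurableSpace.pi : MeasurableSpace (Fin k → ℝ)) = MeasurableSpace.generateFrom
      (pi univ '' pi univ fun _ => range Iic) := by
    rw [← generateFrom_pi_eq fun _ => isCountablySpanning_range_Iic]
    congr 1
    ext1 i
    rw [← borel_eq_generateFrom_Iic ℝ]
    exact BorelSpace.measurable_eq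
  intro A hA
  induction A, hA using MeasurableSpace.induction_on_inter hgen
    (IsPiSystem.pi fun _ => isPiSystem_Iic) with
  | empty => simpa using isApproximable_zero
  | basic t ht =>
    obtain ⟨s, hs, rfl⟩ := ht
    choose a ha using fun i => hs i (mem_univ i)
    convert isApproximable_indicator_Iic_inter_cube (H := H) N a using 3
    ext u
    simp only [mem_preimage, Set.mem_pi, mem_univ, true_imp_iff, ← ha, mem_Iic, mem_ofPred_eq]
  | compl t htm ih =>
    have := (isApproximable_indicator_cube (H := H) N).addMul h2 (-1) ih
    convert this using 2 with u
    by_cases hu : u ∈ cube k N <;> by_cases hu' : u.ofLp ∈ t <;> simp [indicator, hu, hu']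
  | iUnion f hd hfm ih =>
    set g : ℕ → Set (Space k) := fun n => (WithLp.ofLp (p := 2) ⁻¹' f n) ∩ cube k N with hg
    have hgm : ∀ n, MeasurableSet (g n) := fun n =>
      (WithLp.measurable_ofLp 2 _ (hfm n)).inter hcube
    have hgd : ∀ s : Set ℕ, s.PairwiseDisjoint g := fun s i _ j _ hij =>
      ((hd hij).preimage _).mono inter_subset_left inter_subset_left
    have hU : (WithLp.ofLp (p := 2) ⁻¹' ⋃ n, f n) ∩ cube k N = ⋃ n, g n := by
      rw [preimage_iUnion, iUnion_inter]
    rw [hU]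
    have hsum : ∀ n u, ∑ i ∈ Finset.range n, (1 : ℝ) * (g i).indicator (fun _ => 1) u =
        (⋃ i ∈ Finset.range n, g i).indicator (fun _ => 1) u := by
      intro n u
      rw [Finset.indicator_biUnion_apply (Finset.range n) g (hgd _)]
      simp
    have hUm : MeasurableSet (⋃ n, g n) := MeasurableSet.iUnion hgm
    refine IsApproximable.of_tendsto h2 (measurable_const.indicator hUm)
      (fun n => IsApproximable.sum h2 (Finset.range n) (fun _ => 1) fun i _ => ih i) ?_
    refine tendsto_absNormSq_zero (memAbsH_indicator_cube h1 N) (fun n => ?_) (fun n u => ?_)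
      fun u => ?_
    · exact (Finset.measurable_fun_sum _ fun i _ =>
        (measurable_const.indicator (hgm i)).const_mul _).sub (measurable_const.indicator hUm)
    · rw [hsum]
      have hsub : (⋃ i ∈ Finset.range n, g i) ⊆ ⋃ i, g i :=
        iUnion₂_subset fun i _ => subset_iUnion g i
      have hsub' : (⋃ i, g i) ⊆ cube k N := iUnion_subset fun i => inter_subset_right
      by_cases a1 : u ∈ ⋃ i ∈ Finset.range n, g i
      · rw [indicator_of_mem a1, indicator_of_mem (hsub a1)]; simp
      · by_cases a2 : u ∈ ⋃ i, g i
        · rw [indicator_of_notMem a1, indicator_of_mem a2, indicator_of_mem (hsub' a2)]; simp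
        · rw [indicator_of_notMem a1, indicator_of_notMem a2]; simp
    · have t1 := (tendsto_indicator_biUnion_finset (ι := ℕ) g (fun _ => (1 : ℝ)) u).mono_right
        (pure_le_nhds _)
      have t2 := (t1.comp tendsto_finset_range).sub_const ((⋃ n, g n).indicator (fun _ => 1) u)
      rw [sub_self] at t2
      exact t2.congr fun n => congrArg (· - _) (hsum n u).symm

theorem simpleFunc_eq_sum_indicator {α : Type*} [MeasurableSpace α] (s : SimpleFunc α ℝ) (u : α) :
    s u = ∑ y ∈ s.range, y * (s ⁻¹' {y}).indicator (fun _ => (1 : ℝ)) u := by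
  rw [Finset.sum_eq_single (s u)]
  · simp
  · intro y _ hy
    rw [indicator_of_notMem, mul_zero]
    simpa using hy.symm
  · intro h
    exact absurd (SimpleFunc.mem_range_self s u) h

/-- Elementary functions are dense in `|𝓗^H|`: a function is the dominated limit of simple functions
cut off to cubes. -/
theorem isApproximable_of_memAbsH (h1 : ∀ i, 1 / 2 ≤ H i) (h2 : ∀ i, H i < 1) {f : Space k → ℝ}
    (hf : MemAbsH H f) : IsApproximable H f := by
  set s : ℕ → SimpleFunc (Space k) ℝ := fun n =>
    SimpleFunc.approxOn f hf.1 univ 0 (mem_univ _) n with hs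
  have hcube : ∀ n, MeasurableSet (cube k n) := fun n => measurableSet_box _ _
  have happ : ∀ n, IsApproximable H ((cube k n).indicator (s n)) := by
    intro n
    have := IsApproximable.sum h2 (s n).range (fun y => y) (H := H)
      (f := fun y => ((s n ⁻¹' {y}) ∩ cube k n).indicator fun _ => (1 : ℝ)) fun y _ =>
        isApproximable_indicator_inter_cube h1 h2 n ((s n).measurableSet_fiber y)
    convert this using 2 with u
    by_cases hu : u ∈ cube k n
    · rw [indicator_of_mem hu, simpleFunc_eq_sum_indicator (s n) u]
      refine Finset.sum_congr rfl fun y _ => ?_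
      congr 1
      simp [indicator, hu]
    · rw [indicator_of_notMem hu, Finset.sum_eq_zero]
      intro y _
      rw [indicator_of_notMem (fun h => hu h.2), mul_zero]
  refine IsApproximable.of_tendsto h2 hf.1 happ ?_
  -- the `n`-th simple function is at most `2 |f|`, so its distance to `f` is at most `3 |f|`
  refine tendsto_absNormSq_zero (hf.const_mul 3) (fun n => ?_) (fun n u => ?_) fun u => ?_
  · exact ((s n).measurable.indicator (hcube n)).sub hf.1
  · rw [enorm_le_iff_norm_le]
    refine (norm_sub_le _ _).trans ?_
    have b1 : ‖(cube k n).indicator (s n) u‖ ≤ ‖s n u‖ := norm_indicator_le_norm_self _ _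
    have b2 : ‖s n u‖ ≤ ‖f u‖ + ‖f u‖ := SimpleFunc.norm_approxOn_zero_le hf.1 (mem_univ _) u n
    rw [norm_mul, Real.norm_of_nonneg (by norm_num : (0 : ℝ) ≤ 3)]
    linarith
  · have t1 : Tendsto (fun n => s n u) atTop (𝓝 (f u)) :=
      SimpleFunc.tendsto_approxOn hf.1 (mem_univ _) (by simp)
    have t2 : Tendsto (fun n => (cube k n).indicator (s n) u) atTop (𝓝 (f u)) := by
      refine t1.congr' ?_
      obtain ⟨N, hN⟩ := exists_nat_ge ‖u‖
      filter_upwards [eventually_ge_atTop N] with n hn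
      rw [indicator_of_mem]
      intro i
      have := (PiLp.norm_apply_le u i).trans (hN.trans (Nat.cast_le.2 hn))
      rw [Real.norm_eq_abs, abs_le] at this
      exact this
    simpa using t2.sub_const (f u)

end FracPoisson

namespace FracPoisson

/-! ### The integral of a function of `|𝓗^H|` against the field -/

theorem eLpNorm_two_eq_ofReal_sqrt {Ω : Type*} [MeasurableSpace Ω] {P : Measure Ω} {f : Ω → ℝ}
    (hf : MemLp f 2 P) : eLpNorm f 2 P = ENNReal.ofReal √(∫ ω, f ω ^ 2 ∂P) := by
  rw [hf.eLpNorm_eq_integral_rpow_norm (by simp) (by simp)]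
  congr 1
  rw [Real.sqrt_eq_rpow]
  simp

variable {k : ℕ} {H : Fin k → ℝ} {Ω : Type*} [MeasurableSpace Ω] {P : Measure Ω}
  {B : Space k → Ω → ℝ}

theorem eLpNorm_integral (h1 : ∀ i, 1 / 2 ≤ H i) (h2 : ∀ i, H i < 1)
    (hB : IsFractionalBrownianField H B P) (e : Elementary k) :
    eLpNorm (fun ω => e.integral B ω) 2 P = ENNReal.ofReal √(hNormSq H e.toFun) := by
  rw [← integral_elementary_sq h1 h2 hB]
  exact eLpNorm_two_eq_ofReal_sqrt (memLp_integral hB e)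

/-- Elementary functions that are close to a common function of `|𝓗^H|` have close integrals. -/
theorem eLpNorm_integral_sub_le (h1 : ∀ i, 1 / 2 ≤ H i) (h2 : ∀ i, H i < 1)
    (hB : IsFractionalBrownianField H B P) {φ : Space k → ℝ} (hφ : MemAbsH H φ)
    (e e' : Elementary k) :
    eLpNorm (fun ω => e.integral B ω - e'.integral B ω) 2 P ≤
      ENNReal.ofReal √(2 * hNormSq H (fun u => e.toFun u - φ u) +
        2 * hNormSq H (fun u => e'.toFun u - φ u)) := by
  have e1 : (fun ω => e.integral B ω - e'.integral B ω) =
      fun ω => (e.addMul (-1) e').integral B ω := by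
    ext ω; rw [Elementary.integral_addMul]; ring
  have e2 : (e.addMul (-1) e').toFun =
      fun u => (e.toFun u - φ u) - (e'.toFun u - φ u) := by
    ext u; rw [Elementary.toFun_addMul]; ring
  rw [e1, eLpNorm_integral h1 h2 hB, e2]
  exact ENNReal.ofReal_le_ofReal (Real.sqrt_le_sqrt
    (hNormSq_sub_le h2 ((memAbsH_elementary h1 h2 e).sub h2 hφ)
      ((memAbsH_elementary h1 h2 e').sub h2 hφ)))

theorem tendsto_ofReal_sqrt_zero {a b : ℕ → ℝ} (ha : Tendsto a atTop (𝓝 0))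
    (hb : Tendsto b atTop (𝓝 0)) :
    Tendsto (fun n => ENNReal.ofReal √(2 * a n + 2 * b n)) atTop (𝓝 0) := by
  have h := ENNReal.tendsto_ofReal (((ha.const_mul 2).add (hb.const_mul 2)).sqrt)
  simpa using h

/-- The integral does not depend on the approximating sequence. -/
theorem IsFieldIntegral.ae_eq (h1 : ∀ i, 1 / 2 ≤ H i) (h2 : ∀ i, H i < 1)
    (hB : IsFractionalBrownianField H B P) {φ : Space k → ℝ} {Y Z : Ω → ℝ}
    (hY : IsFieldIntegral H B P φ Y) (hZ : IsFieldIntegral H B P φ Z) : Y =ᵐ[P] Z := by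
  obtain ⟨hφ, mY, e, he, heY⟩ := hY
  obtain ⟨-, mZ, e', he', heZ⟩ := hZ
  have hle : ∀ n, eLpNorm (fun ω => Y ω - Z ω) 2 P ≤
      eLpNorm (fun ω => (e n).integral B ω - Y ω) 2 P +
      ENNReal.ofReal √(2 * hNormSq H (fun u => (e n).toFun u - φ u) +
        2 * hNormSq H (fun u => (e' n).toFun u - φ u)) +
      eLpNorm (fun ω => (e' n).integral B ω - Z ω) 2 P := by
    intro n
    have m1 := (memLp_integral hB (e n))
    have m2 := (memLp_integral hB (e' n))
    have d : (fun ω => Y ω - Z ω) = (fun ω => Y ω - (e n).integral B ω) +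
        ((fun ω => (e n).integral B ω - (e' n).integral B ω) +
          fun ω => (e' n).integral B ω - Z ω) := by
      ext ω; simp
    rw [d, add_assoc]
    refine (eLpNorm_add_le (mY.sub m1).1 ((m1.sub m2).add (m2.sub mZ)).1 (by simp)).trans ?_
    refine add_le_add (le_of_eq (eLpNorm_sub_comm _ _ _ _)) ?_
    refine (eLpNorm_add_le (m1.sub m2).1 (m2.sub mZ).1 (by simp)).trans ?_
    exact add_le_add_left (eLpNorm_integral_sub_le h1 h2 hB hφ _ _) _
  have hlim := (heY.add (tendsto_ofReal_sqrt_zero he he')).add heZ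
  simp only [add_zero] at hlim
  have h0 : eLpNorm (fun ω => Y ω - Z ω) 2 P = 0 :=
    le_antisymm (ge_of_tendsto' hlim hle) zero_le
  filter_upwards [(eLpNorm_eq_zero_iff (mY.sub mZ).1 (by simp)).1 h0] with ω hω
  exact sub_eq_zero.1 hω

/-- The integral is bounded in `L²`. The factor `2` comes from `hNormSq_sub_le`, used in place of
the triangle inequality in `𝓗^H`. -/
theorem IsFieldIntegral.integral_sq_le (h1 : ∀ i, 1 / 2 ≤ H i) (h2 : ∀ i, H i < 1)
    (hB : IsFractionalBrownianField H B P) {φ : Space k → ℝ} {Y : Ω → ℝ}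
    (hY : IsFieldIntegral H B P φ Y) : ∫ ω, Y ω ^ 2 ∂P ≤ 2 * hNormSq H φ := by
  obtain ⟨hφ, mY, e, he, heY⟩ := hY
  have hle : ∀ n, eLpNorm Y 2 P ≤ eLpNorm (fun ω => (e n).integral B ω - Y ω) 2 P +
      ENNReal.ofReal √(2 * hNormSq H (fun u => (e n).toFun u - φ u) + 2 * hNormSq H φ) := by
    intro n
    have m1 := (memLp_integral hB (e n))
    have d : Y = (fun ω => Y ω - (e n).integral B ω) + fun ω => (e n).integral B ω := by
      ext ω; simp
    have d' : (e n).toFun = fun u => ((e n).toFun u - φ u) - -φ u := by ext u; ring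
    conv_lhs => rw [d]
    refine (eLpNorm_add_le (mY.sub m1).1 m1.1 (by simp)).trans ?_
    refine add_le_add (le_of_eq (eLpNorm_sub_comm _ _ _ _)) ?_
    rw [eLpNorm_integral h1 h2 hB]
    refine ENNReal.ofReal_le_ofReal (Real.sqrt_le_sqrt ?_)
    conv_lhs => rw [d']
    rw [← hNormSq_neg φ]
    exact hNormSq_sub_le h2 ((memAbsH_elementary h1 h2 _).sub h2 hφ) hφ.neg
  have hlim := heY.add (ENNReal.tendsto_ofReal
    (((he.const_mul 2).add_const (2 * hNormSq H φ)).sqrt))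
  simp only [mul_zero, zero_add] at hlim
  have h0 := ge_of_tendsto' hlim hle
  rw [eLpNorm_two_eq_ofReal_sqrt mY, ENNReal.ofReal_le_ofReal_iff (Real.sqrt_nonneg _)] at h0
  exact (Real.sqrt_le_sqrt_iff (mul_nonneg zero_le_two (hNormSq_nonneg h2 hφ))).1 h0

/-- Every function of `|𝓗^H|` has an integral against the field: by density, it is a limit of
elementary functions, and by the isometry the integrals of the latter form a Cauchy sequence. -/
theorem exists_isFieldIntegral (h1 : ∀ i, 1 / 2 ≤ H i) (h2 : ∀ i, H i < 1)
    (hB : IsFractionalBrownianField H B P) {φ : Space k → ℝ} (hφ : MemAbsH H φ) :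
    ∃ Y : Ω → ℝ, IsFieldIntegral H B P φ Y := by
  have hpos : ∀ n : ℕ, 0 < ENNReal.ofReal (1 / ((n : ℝ) + 1)) := fun n =>
    ENNReal.ofReal_pos.2 (by positivity)
  choose e he using fun n : ℕ => (isApproximable_of_memAbsH h1 h2 hφ).2 _ (hpos n)
  set a : ℕ → ℝ := fun n => hNormSq H fun u => (e n).toFun u - φ u with ha
  have ha0 : ∀ n, 0 ≤ a n := fun n =>
    hNormSq_nonneg h2 ((memAbsH_elementary h1 h2 (e n)).sub h2 hφ)
  have hale : ∀ n, a n ≤ 1 / ((n : ℝ) + 1) := fun n =>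
    (hNormSq_le_toReal _).trans (ENNReal.toReal_le_of_le_ofReal (by positivity) (he n))
  have hlim : Tendsto a atTop (𝓝 0) :=
    squeeze_zero ha0 hale tendsto_one_div_add_atTop_nhds_zero_nat
  have hmem : ∀ n, MemLp ((e n).integral B) 2 P := fun n => memLp_integral hB (e n)
  set X : ℕ → Lp ℝ 2 P := fun n => (hmem n).toLp _ with hX
  have hb : Tendsto (fun N : ℕ => √(4 * (1 / ((N : ℝ) + 1)))) atTop (𝓝 0) := by
    simpa using (tendsto_one_div_add_atTop_nhds_zero_nat (𝕜 := ℝ).const_mul 4).sqrt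
  have hcau : CauchySeq X := by
    refine cauchySeq_of_le_tendsto_0 _ (fun n m N hn hm => ?_) hb
    rw [dist_eq_norm, hX, ← MemLp.toLp_sub, Lp.norm_toLp]
    refine ENNReal.toReal_le_of_le_ofReal (Real.sqrt_nonneg _) ?_
    refine (eLpNorm_integral_sub_le h1 h2 hB hφ (e n) (e m)).trans ?_
    refine ENNReal.ofReal_le_ofReal (Real.sqrt_le_sqrt ?_)
    have hn' : a n ≤ 1 / ((N : ℝ) + 1) := (hale n).trans (by gcongr)
    have hm' : a m ≤ 1 / ((N : ℝ) + 1) := (hale m).trans (by gcongr)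
    change 2 * a n + 2 * a m ≤ _
    linarith
  obtain ⟨L, hL⟩ := cauchySeq_tendsto_of_complete hcau
  refine ⟨L, hφ, Lp.memLp L, e, hlim, ?_⟩
  rw [Lp.tendsto_Lp_iff_tendsto_eLpNorm'] at hL
  refine hL.congr fun n => eLpNorm_congr_ae ?_
  filter_upwards [(hmem n).coeFn_toLp] with ω hω
  simp [hX, hω]

end FracPoisson

namespace FracPoisson

/-! ### One-dimensional singular integrals -/

theorem lintegral_Icc_enorm_rpow_lt_top {s : ℝ} (hs : s < 1) :
    ∫⁻ t in Icc (-1 : ℝ) 1, ‖t‖ₑ ^ (-s) < ∞ := by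
  have h := intervalIntegrable_abs_rpow (by linarith : -1 < -s) (-1) 1
  have e : ∀ᵐ t : ℝ, ‖t‖ₑ ^ (-s) = ENNReal.ofReal (|t| ^ (-s)) := by
    filter_upwards [compl_mem_ae_iff.2 (measure_singleton (μ := volume) (0 : ℝ))] with t ht
    have : 0 < |t| := abs_pos.2 ht
    rw [← ENNReal.ofReal_rpow_of_pos this, Real.enorm_eq_ofReal_abs]
  rw [lintegral_congr_ae (ae_restrict_of_ae e),
    lintegral_Icc_eq_ofReal (by norm_num) h fun x => by positivity]
  exact ENNReal.ofReal_lt_top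

/-- A bound for the integral of a translate of `|t|^{-s}` over `[-R, R]`. -/
noncomputable def singConst (s R : ℝ) : ℝ≥0∞ :=
  (∫⁻ t in Icc (-1 : ℝ) 1, ‖t‖ₑ ^ (-s)) + volume (Icc (-R) R)

theorem singConst_lt_top {s : ℝ} (hs : s < 1) (R : ℝ) : singConst s R < ∞ :=
  ENNReal.add_lt_top.2 ⟨lintegral_Icc_enorm_rpow_lt_top hs, by simp⟩

/-- The singularity is at most `1` at distance at least `1` from its pole, so the bound is uniform
in the pole `z`. -/
theorem lintegral_Icc_enorm_sub_rpow_le {s : ℝ} (hs : 0 ≤ s) (R z : ℝ) :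
    ∫⁻ t in Icc (-R) R, ‖z - t‖ₑ ^ (-s) ≤ singConst s R := by
  have hle : ∀ t, (Icc (-R) R).indicator (fun t => ‖z - t‖ₑ ^ (-s)) t ≤
      (Icc (-1 : ℝ) 1).indicator (fun t => ‖t‖ₑ ^ (-s)) (z - t) +
        (Icc (-R) R).indicator (fun _ => 1) t := by
    intro t
    by_cases ht : t ∈ Icc (-R) R
    · rw [indicator_of_mem ht, indicator_of_mem ht]
      by_cases h : z - t ∈ Icc (-1 : ℝ) 1
      · rw [indicator_of_mem h]; exact le_self_add
      · refine le_trans ?_ le_add_self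
        have h1 : 1 ≤ ‖z - t‖ₑ := by
          rw [Real.enorm_eq_ofReal_abs, ENNReal.one_le_ofReal]
          by_contra hc
          exact h (abs_le.1 (not_le.1 hc).le)
        rw [ENNReal.rpow_neg]
        exact ENNReal.inv_le_one.2 (by simpa using ENNReal.rpow_le_rpow h1 hs)
    · rw [indicator_of_notMem ht]; exact zero_le
  rw [← lintegral_indicator measurableSet_Icc, singConst]
  refine (lintegral_mono hle).trans ?_
  rw [lintegral_add_right _ (measurable_const.indicator measurableSet_Icc),
    lintegral_sub_left_eq_self (fun t => (Icc (-1 : ℝ) 1).indicator (fun t => ‖t‖ₑ ^ (-s)) t) z,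
    lintegral_indicator measurableSet_Icc, lintegral_indicator measurableSet_Icc]
  simp

/-- The singularity `|z-t|^{-a}`, restricted to `t ∈ [-R, R]`. Its value at the pole `t = z` is `∞`
when `a > 0`. -/
noncomputable def sing (R a z t : ℝ) : ℝ≥0∞ :=
  (Icc (-R) R).indicator (fun t => ‖z - t‖ₑ ^ (-a)) t

theorem measurable_sing (R a : ℝ) : Measurable fun q : ℝ × ℝ => sing R a q.1 q.2 := by
  have h : Measurable fun q : ℝ × ℝ => ‖q.1 - q.2‖ₑ ^ (-a) := by fun_prop
  exact h.indicator (measurable_snd measurableSet_Icc)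

theorem measurable_sing_right (R a z : ℝ) : Measurable (sing R a z) :=
  (measurable_sing R a).comp (measurable_prodMk_left (x := z))

theorem lintegral_sing_rpow_le {h θ : ℝ} (hh : 0 < h) (hθ : 0 ≤ θ) (R z : ℝ) :
    ∫⁻ t, sing R (h * θ) z t ^ (1 / h) ≤ singConst θ R := by
  refine le_trans (le_of_eq ?_) (lintegral_Icc_enorm_sub_rpow_le hθ R z)
  rw [← lintegral_indicator measurableSet_Icc]
  refine lintegral_congr fun t => ?_
  by_cases ht : t ∈ Icc (-R) R
  · rw [sing, indicator_of_mem ht, indicator_of_mem ht, ← ENNReal.rpow_mul]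
    congr 1
    field_simp
  · rw [sing, indicator_of_notMem ht, indicator_of_notMem ht,
      ENNReal.zero_rpow_of_pos (by positivity)]

/-- A crude form of the weighted inequality between the arithmetic and geometric means. -/
theorem rpow_mul_rpow_mul_rpow_le {α β γ : ℝ} (hα : 0 ≤ α) (hβ : 0 ≤ β) (hγ : 0 ≤ γ)
    (h : α + β + γ = 1) (x y w : ℝ≥0∞) : x ^ α * y ^ β * w ^ γ ≤ x + y + w := by
  set m := x + y + w with hm
  have hx : x ≤ m := le_self_add.trans le_self_add
  have hy : y ≤ m := le_add_self.trans le_self_add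
  have hw : w ≤ m := le_add_self
  calc x ^ α * y ^ β * w ^ γ ≤ m ^ α * m ^ β * m ^ γ := by gcongr
    _ = m := by
      rw [← ENNReal.rpow_add_of_nonneg _ _ hα hβ,
        ← ENNReal.rpow_add_of_nonneg _ _ (add_nonneg hα hβ) hγ, h, ENNReal.rpow_one]

theorem kernel1_le (h s t : ℝ) (h1 : 1 / 2 < h) (h2 : h < 1) :
    kernel1 h s t ≤ ENNReal.ofReal (h * (2 * h - 1)) * ‖s - t‖ₑ ^ (-(2 - 2 * h)) := by
  have hc : 0 ≤ h * (2 * h - 1) := mul_nonneg (by linarith) (by linarith)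
  rw [kernel1, ENNReal.ofReal_mul hc]
  gcongr
  rcases eq_or_ne s t with rfl | hst
  · rw [sub_self, abs_zero, Real.zero_rpow (by linarith)]; simp
  · have : 0 < |s - t| := abs_pos.2 (sub_ne_zero.2 hst)
    rw [← ENNReal.ofReal_rpow_of_pos this, Real.enorm_eq_ofReal_abs, neg_sub]

/-- Splitting of the singularities in the one-dimensional form, by the inequality between arithmetic
and geometric means with weights `2hσ - 1`, `1 - hσ`, `1 - hσ`. Each term on the right has only two
of the three singularities, and their orders are less than one when `θ < σ < 1`. -/
theorem singularity_le {h θ σ : ℝ} (hσ0 : 0 < σ) (h1 : 1 ≤ 2 * (h * σ))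
    (h2 : h * σ < 1) (A B C : ℝ≥0∞) :
    C ^ (-(2 - 2 * h)) * A ^ (-(h * θ)) * B ^ (-(h * θ)) ≤
      A ^ (-(θ / σ)) * B ^ (-(θ / σ)) +
        A ^ (-(θ / σ)) * C ^ (-((1 - h) / (1 - h * σ))) +
        B ^ (-(θ / σ)) * C ^ (-((1 - h) / (1 - h * σ))) := by
  set α := 2 * (h * σ) - 1 with hα
  set β := 1 - h * σ with hβ
  have hα0 : 0 ≤ α := by linarith
  have hβ0 : 0 < β := by linarith
  refine le_trans (le_of_eq ?_) (rpow_mul_rpow_mul_rpow_le hα0 hβ0.le hβ0.le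
    (by rw [hα, hβ]; ring) _ _ _)
  set a := A ^ (-(θ / σ)) with ha
  set b := B ^ (-(θ / σ)) with hb
  set c := C ^ (-((1 - h) / β)) with hc
  have ea : A ^ (-(h * θ)) = a ^ α * a ^ β := by
    rw [← ENNReal.rpow_add_of_nonneg _ _ hα0 hβ0.le, ha, ← ENNReal.rpow_mul]
    congr 1
    rw [hα, hβ]; field_simp; ring
  have eb : B ^ (-(h * θ)) = b ^ α * b ^ β := by
    rw [← ENNReal.rpow_add_of_nonneg _ _ hα0 hβ0.le, hb, ← ENNReal.rpow_mul]
    congr 1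
    rw [hα, hβ]; field_simp; ring
  have ec : C ^ (-(2 - 2 * h)) = c ^ β * c ^ β := by
    rw [← ENNReal.rpow_add_of_nonneg _ _ hβ0.le hβ0.le, hc, ← ENNReal.rpow_mul]
    congr 1
    field_simp; ring
  rw [ea, eb, ec, ENNReal.mul_rpow_of_nonneg _ _ hα0, ENNReal.mul_rpow_of_nonneg _ _ hβ0.le,
    ENNReal.mul_rpow_of_nonneg _ _ hβ0.le]
  ring

theorem lintegral_lintegral_singularity_le {p r : ℝ} (hp : 0 ≤ p) (hr : 0 ≤ r) (R z z' : ℝ) :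
    ∫⁻ s in Icc (-R) R, ∫⁻ t in Icc (-R) R, (‖z - s‖ₑ ^ (-p) * ‖z' - t‖ₑ ^ (-p) +
        ‖z - s‖ₑ ^ (-p) * ‖s - t‖ₑ ^ (-r) + ‖z' - t‖ₑ ^ (-p) * ‖s - t‖ₑ ^ (-r)) ≤
      singConst p R * singConst p R + singConst p R * singConst r R +
        singConst p R * singConst r R := by
  have e1 : ∀ s, ∫⁻ t in Icc (-R) R, (‖z - s‖ₑ ^ (-p) * ‖z' - t‖ₑ ^ (-p) +
        ‖z - s‖ₑ ^ (-p) * ‖s - t‖ₑ ^ (-r) + ‖z' - t‖ₑ ^ (-p) * ‖s - t‖ₑ ^ (-r)) ≤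
      ‖z - s‖ₑ ^ (-p) * singConst p R + ‖z - s‖ₑ ^ (-p) * singConst r R +
        ∫⁻ t in Icc (-R) R, ‖z' - t‖ₑ ^ (-p) * ‖s - t‖ₑ ^ (-r) := by
    intro s
    rw [lintegral_add_left (by fun_prop), lintegral_add_left (by fun_prop),
      lintegral_const_mul _ (by fun_prop), lintegral_const_mul _ (by fun_prop)]
    gcongr
    · exact lintegral_Icc_enorm_sub_rpow_le hp R z'
    · exact lintegral_Icc_enorm_sub_rpow_le hr R s
  refine (lintegral_mono e1).trans ?_
  rw [lintegral_add_left (by fun_prop), lintegral_add_left (by fun_prop),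
      lintegral_mul_const _ (by fun_prop), lintegral_mul_const _ (by fun_prop)]
  have hz := lintegral_Icc_enorm_sub_rpow_le hp R z
  gcongr
  rw [lintegral_lintegral_swap (by fun_prop)]
  have e2 : ∀ t, ∫⁻ s in Icc (-R) R, ‖z' - t‖ₑ ^ (-p) * ‖s - t‖ₑ ^ (-r) ≤
      ‖z' - t‖ₑ ^ (-p) * singConst r R := by
    intro t
    rw [lintegral_const_mul _ (by fun_prop)]
    gcongr
    simp only [enorm_sub_rev _ t]
    exact lintegral_Icc_enorm_sub_rpow_le hr R t
  refine (lintegral_mono e2).trans ?_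
  rw [lintegral_mul_const _ (by fun_prop)]
  gcongr
  exact lintegral_Icc_enorm_sub_rpow_le hp R z'

/-- The one-dimensional form is bounded on the singularities `|z-t|^{-hθ}`, `θ < 1`, uniformly in
their positions. -/
theorem exists_kerForm1_sing_le {h θ : ℝ} (h1 : 1 / 2 ≤ h) (h2 : h < 1) (hθ0 : 0 ≤ θ)
    (hθ : θ < 1) (R : ℝ) :
    ∃ C : ℝ≥0∞, C < ∞ ∧ ∀ z z', kerForm1 h (sing R (h * θ) z) (sing R (h * θ) z') ≤ C := by
  rcases h1.eq_or_lt with rfl | h1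
  · refine ⟨singConst θ R + singConst θ R, ENNReal.add_lt_top.2
      ⟨singConst_lt_top hθ R, singConst_lt_top hθ R⟩, fun z z' => ?_⟩
    rw [kerForm1, if_neg (lt_irrefl _)]
    have hle : ∀ t, sing R (1 / 2 * θ) z t * sing R (1 / 2 * θ) z' t ≤
        (Icc (-R) R).indicator (fun t => ‖z - t‖ₑ ^ (-θ) + ‖z' - t‖ₑ ^ (-θ)) t := by
      intro t
      by_cases ht : t ∈ Icc (-R) R
      · rw [sing, sing, indicator_of_mem ht, indicator_of_mem ht, indicator_of_mem ht]
        have := rpow_mul_rpow_mul_rpow_le (α := 1 / 2) (β := 1 / 2) (γ := 0) (by norm_num)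
          (by norm_num) le_rfl (by norm_num) (‖z - t‖ₑ ^ (-θ)) (‖z' - t‖ₑ ^ (-θ)) 0
        rw [ENNReal.rpow_zero, mul_one, add_zero, ← ENNReal.rpow_mul, ← ENNReal.rpow_mul] at this
        rwa [show -(1 / 2 * θ) = -θ * (1 / 2) by ring]
      · rw [sing, indicator_of_notMem ht, zero_mul]; exact zero_le
    refine (lintegral_mono hle).trans ?_
    rw [lintegral_indicator measurableSet_Icc, lintegral_add_left (by fun_prop)]
    exact add_le_add (lintegral_Icc_enorm_sub_rpow_le hθ0 R z)
      (lintegral_Icc_enorm_sub_rpow_le hθ0 R z')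
  · -- any `σ < 1` larger than `θ` and `1/(2h)` works
    obtain ⟨σ, hσ, hσ1⟩ := exists_between
      (max_lt hθ (by rw [div_lt_one (by linarith)]; linarith : 1 / (2 * h) < 1))
    obtain ⟨hσθ, hσh⟩ := max_lt_iff.1 hσ
    have hσ0 : 0 < σ := hθ0.trans_lt hσθ
    have c1 : 1 ≤ 2 * (h * σ) := by
      rw [div_lt_iff₀ (by linarith)] at hσh; nlinarith
    have c2 : h < 1 ∧ h * σ < h := ⟨h2, by nlinarith⟩
    have c3 : 0 < 1 - h * σ := by linarith
    set p := θ / σ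
    set r := (1 - h) / (1 - h * σ)
    have hp0 : 0 ≤ p := by positivity
    have hp1 : p < 1 := (div_lt_one hσ0).2 hσθ
    have hr0 : 0 ≤ r := div_nonneg (by linarith) c3.le
    have hr1 : r < 1 := (div_lt_one c3).2 (by linarith)
    have tp := singConst_lt_top hp1 R
    have tr := singConst_lt_top hr1 R
    refine ⟨ENNReal.ofReal (h * (2 * h - 1)) * (singConst p R * singConst p R +
      singConst p R * singConst r R + singConst p R * singConst r R), ?_, fun z z' => ?_⟩
    · exact ENNReal.mul_lt_top ENNReal.ofReal_lt_top (ENNReal.add_lt_top.2 ⟨ENNReal.add_lt_top.2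
        ⟨ENNReal.mul_lt_top tp tp, ENNReal.mul_lt_top tp tr⟩, ENNReal.mul_lt_top tp tr⟩)
    rw [kerForm1, if_pos h1]
    set G : ℝ → ℝ → ℝ≥0∞ := fun s t => ‖z - s‖ₑ ^ (-p) * ‖z' - t‖ₑ ^ (-p) +
        ‖z - s‖ₑ ^ (-p) * ‖s - t‖ₑ ^ (-r) + ‖z' - t‖ₑ ^ (-p) * ‖s - t‖ₑ ^ (-r) with hG
    have hle : ∀ s t, kernel1 h s t * sing R (h * θ) z s * sing R (h * θ) z' t ≤
        ENNReal.ofReal (h * (2 * h - 1)) *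
          (Icc (-R) R).indicator (fun s => (Icc (-R) R).indicator (fun t => G s t) t) s := by
      intro s t
      by_cases hs : s ∈ Icc (-R) R
      · by_cases ht : t ∈ Icc (-R) R
        · rw [sing, sing, indicator_of_mem hs, indicator_of_mem ht, indicator_of_mem hs,
            indicator_of_mem ht]
          calc _ ≤ ENNReal.ofReal (h * (2 * h - 1)) * ‖s - t‖ₑ ^ (-(2 - 2 * h)) *
                ‖z - s‖ₑ ^ (-(h * θ)) * ‖z' - t‖ₑ ^ (-(h * θ)) := by
                gcongr
                exact kernel1_le h s t h1 h2
            _ = ENNReal.ofReal (h * (2 * h - 1)) * (‖s - t‖ₑ ^ (-(2 - 2 * h)) *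
                ‖z - s‖ₑ ^ (-(h * θ)) * ‖z' - t‖ₑ ^ (-(h * θ))) := by ring
            _ ≤ _ := mul_le_mul' le_rfl (singularity_le hσ0 c1 (by linarith) _ _ _)
        · rw [sing, sing, indicator_of_notMem ht, mul_zero]; exact zero_le
      · rw [sing, indicator_of_notMem hs, mul_zero, zero_mul]; exact zero_le
    have hGs : ∀ s, Measurable (G s) := fun s => by rw [hG]; fun_prop
    calc _ ≤ ∫⁻ s, ∫⁻ t, ENNReal.ofReal (h * (2 * h - 1)) *
          (Icc (-R) R).indicator (fun s => (Icc (-R) R).indicator (fun t => G s t) t) s :=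
          lintegral_mono fun s => lintegral_mono fun t => hle s t
      _ = ENNReal.ofReal (h * (2 * h - 1)) *
          ∫⁻ s in Icc (-R) R, ∫⁻ t in Icc (-R) R, G s t := by
          rw [← lintegral_indicator measurableSet_Icc,
            ← lintegral_const_mul' _ _ ENNReal.ofReal_ne_top]
          refine lintegral_congr fun s => ?_
          rw [lintegral_const_mul' _ _ ENNReal.ofReal_ne_top]
          congr 1
          by_cases hs : s ∈ Icc (-R) R
          · simp only [indicator_of_mem hs]
            rw [lintegral_indicator measurableSet_Icc]
          · simp [indicator_of_notMem hs]
      _ ≤ _ := mul_le_mul' le_rfl (lintegral_lintegral_singularity_le hp0 hr0 R z z')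

end FracPoisson

namespace FracPoisson

/-! ### Norms of averages of product functions -/

theorem iteratedNorm_mono {n : ℕ} {p : Fin n → ℝ≥0∞} {f g : (Fin n → ℝ) → ℝ≥0∞}
    (h : ∀ η, f η ≤ g η) : iteratedNorm n p f ≤ iteratedNorm n p g := by
  induction n with
  | zero => exact h _
  | succ n ih => exact eLpNorm_mono_enorm fun t => by simpa using ih fun η => h _

/-- Jensen's inequality for a measure `μ` that need not be a probability measure. -/
theorem lintegral_rpow_le {Z : Type*} [MeasurableSpace Z] (μ : Measure Z) {q : ℝ} (hq : 1 < q)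
    {f : Z → ℝ≥0∞} (hf : Measurable f) :
    (∫⁻ z, f z ∂μ) ^ q ≤ μ univ ^ (q - 1) * ∫⁻ z, f z ^ q ∂μ := by
  have hq' := Real.HolderConjugate.conjExponent hq
  have h := ENNReal.lintegral_mul_le_Lp_mul_Lq μ hq' hf.aemeasurable
    (measurable_const (a := (1 : ℝ≥0∞))).aemeasurable
  simp only [Pi.mul_apply, mul_one, ENNReal.one_rpow, lintegral_const, one_mul] at h
  have hq0 : 0 < q := by linarith
  calc (∫⁻ z, f z ∂μ) ^ q ≤ ((∫⁻ z, f z ^ q ∂μ) ^ (1 / q) *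
        μ univ ^ (1 / Real.conjExponent q)) ^ q := ENNReal.rpow_le_rpow h hq0.le
    _ = _ := by
      rw [ENNReal.mul_rpow_of_nonneg _ _ hq0.le, ← ENNReal.rpow_mul, ← ENNReal.rpow_mul, mul_comm]
      congr 2
      · rw [Real.conjExponent]; have := hq'.sub_one_ne_zero; field_simp
      · rw [one_div_mul_cancel hq0.ne', ENNReal.rpow_one]

/-- Minkowski's integral inequality, with a uniform bound on the norms of the integrands. -/
theorem eLpNorm_lintegral_le {Z : Type*} [MeasurableSpace Z] (μ : Measure Z) [SFinite μ]
    {q : ℝ} (hq : 1 < q) {g : Z → ℝ → ℝ≥0∞} (hg : Measurable (Function.uncurry g)) {M : ℝ≥0∞}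
    (hM : ∀ z, ∫⁻ t, g z t ^ q ≤ M ^ q) :
    eLpNorm (fun t => ∫⁻ z, g z t ∂μ) (ENNReal.ofReal q) volume ≤ μ univ * M := by
  have hq0 : 0 < q := by linarith
  have hgt : ∀ t, Measurable fun z => g z t := fun t => hg.comp (measurable_prodMk_right (y := t))
  rw [eLpNorm_eq_lintegral_rpow_enorm_toReal (by simpa using hq0) (by simp),
    ENNReal.toReal_ofReal hq0.le]
  simp only [enorm_eq_self]
  refine (ENNReal.rpow_le_rpow (z := 1 / q) ?_ (by positivity)).trans_eq
    (b := ((μ univ * M) ^ q) ^ (1 / q)) ?_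
  · calc ∫⁻ t, (∫⁻ z, g z t ∂μ) ^ q
        ≤ ∫⁻ t, μ univ ^ (q - 1) * ∫⁻ z, g z t ^ q ∂μ :=
          lintegral_mono fun t => lintegral_rpow_le μ hq (hgt t)
      _ = μ univ ^ (q - 1) * ∫⁻ t, ∫⁻ z, g z t ^ q ∂μ := by
          rw [lintegral_const_mul]
          exact (hg.pow_const q).lintegral_prod_left'
      _ = μ univ ^ (q - 1) * ∫⁻ z, (∫⁻ t, g z t ^ q) ∂μ := by
          rw [lintegral_lintegral_swap]
          exact ((hg.comp measurable_swap).pow_const q).aemeasurable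
      _ ≤ μ univ ^ (q - 1) * ∫⁻ _, M ^ q ∂μ := by
          gcongr with z
          exact hM z
      _ = (μ univ * M) ^ q := by
          rw [lintegral_const, ENNReal.mul_rpow_of_nonneg _ _ hq0.le, mul_comm (M ^ q), ← mul_assoc]
          congr 1
          nth_rw 2 [← ENNReal.rpow_one (μ univ)]
          rw [← ENNReal.rpow_add_of_nonneg _ _ (by linarith) zero_le_one, sub_add_cancel]
  · rw [← ENNReal.rpow_mul, mul_one_div_cancel hq0.ne', ENNReal.rpow_one]

/-- A mixed norm of an average of product functions is bounded by the product of bounds of the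
one-dimensional norms. In the induction over the number of variables, the factor depending on the
last variable is absorbed into the averaging measure. -/
theorem iteratedNorm_lintegral_prod_le {Z : Type*} [MeasurableSpace Z] {n : ℕ}
    (μ : Measure Z) [SFinite μ] {q : Fin n → ℝ} (hq : ∀ i, 1 < q i) {g : Fin n → Z → ℝ → ℝ≥0∞}
    (hg : ∀ i, Measurable (Function.uncurry (g i))) {M : Fin n → ℝ≥0∞}
    (hM : ∀ i z, ∫⁻ t, g i z t ^ q i ≤ M i ^ q i) :
    iteratedNorm n (fun i => ENNReal.ofReal (q i)) (fun η => ∫⁻ z, ∏ i, g i z (η i) ∂μ) ≤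
      μ univ * ∏ i, M i := by
  induction n generalizing μ with
  | zero => simp [iteratedNorm]
  | succ n ih =>
    have hgt : ∀ i t, Measurable fun z => g i z t := fun i t =>
      (hg i).comp (measurable_prodMk_right (y := t))
    have hin : ∀ t, iteratedNorm n (fun i => ENNReal.ofReal (q i.castSucc))
        (fun η => ∫⁻ z, ∏ i, g i z ((Fin.snoc (α := fun _ => ℝ) η t : Fin (n + 1) → ℝ) i) ∂μ) ≤
        (∫⁻ z, g (Fin.last n) z t ∂μ) * ∏ i : Fin n, M i.castSucc := by
      intro t
      have e : ∀ η : Fin n → ℝ,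
          ∫⁻ z, ∏ i, g i z ((Fin.snoc (α := fun _ => ℝ) η t : Fin (n + 1) → ℝ) i) ∂μ =
          ∫⁻ z, ∏ i : Fin n, g i.castSucc z (η i) ∂(μ.withDensity fun z => g (Fin.last n) z t) := by
        intro η
        rw [lintegral_withDensity_eq_lintegral_mul _ (hgt _ t)
          (Finset.measurable_fun_prod _ fun i _ => hgt _ _)]
        refine lintegral_congr fun z => ?_
        rw [Fin.prod_univ_castSucc, Pi.mul_apply, mul_comm]
        simp only [Fin.snoc_castSucc, Fin.snoc_last]
      simp only [e]
      refine (ih _ (fun i => hq _) (fun i => hg _) (fun i z => hM _ z)).trans_eq ?_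
      rw [withDensity_apply _ MeasurableSet.univ, Measure.restrict_univ]
    rw [Fin.prod_univ_castSucc, mul_comm (∏ i : Fin n, M i.castSucc), ← mul_assoc]
    calc iteratedNorm (n + 1) _ _
        ≤ eLpNorm (fun t => (∏ i : Fin n, M i.castSucc) * ∫⁻ z, g (Fin.last n) z t ∂μ)
            (ENNReal.ofReal (q (Fin.last n))) volume := by
          refine eLpNorm_mono_enorm fun t => ?_
          rw [mul_comm]
          exact hin t
      _ ≤ eLpNorm (fun t => ∫⁻ z, (∏ i : Fin n, M i.castSucc) * g (Fin.last n) z t ∂μ)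
            (ENNReal.ofReal (q (Fin.last n))) volume := by
          refine eLpNorm_mono_enorm fun t => ?_
          exact lintegral_const_mul_le _ _
      _ ≤ μ univ * ((∏ i : Fin n, M i.castSucc) * M (Fin.last n)) := by
          refine eLpNorm_lintegral_le μ (hq _) ((hg _).const_mul _) fun z => ?_
          have hq0 : 0 ≤ q (Fin.last n) := zero_le_one.trans (hq _).le
          simp only [ENNReal.mul_rpow_of_nonneg _ _ hq0]
          have hgz : Measurable fun t => g (Fin.last n) z t ^ q (Fin.last n) :=
            ((hg _).comp (measurable_prodMk_left (x := z))).pow_const _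
          rw [lintegral_const_mul _ hgz]
          gcongr
          exact hM _ z
      _ = _ := by ring

variable {k : ℕ} {H : Fin k → ℝ}

theorem kerForm_lintegral_left {Z : Type*} [MeasurableSpace Z] (μ : Measure Z) [SFinite μ]
    {F : Z → Space k → ℝ≥0∞} (hF : Measurable (Function.uncurry F)) {G : Space k → ℝ≥0∞}
    (hG : Measurable G) :
    kerForm H (fun u => ∫⁻ z, F z u ∂μ) G = ∫⁻ z, kerForm H (F z) G ∂μ := by
  unfold kerForm
  have hFu : ∀ u, Measurable fun z => F z u := fun u =>
    hF.comp (measurable_prodMk_right (y := u))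
  have hm : Measurable (Function.uncurry fun (z : Z) (q : Space k × (LongRange H → ℝ)) =>
      ENNReal.ofReal (hurstKernel H q.1 q.2) * F z q.1 * G (splice H q.1 q.2)) := by
    refine Measurable.mul (Measurable.mul ?_ ?_) ?_
    · exact ((measurable_hurstKernel H).comp measurable_snd).ennreal_ofReal
    · exact hF.comp (measurable_fst.prodMk (measurable_fst.comp measurable_snd))
    · exact hG.comp ((measurable_splice H).comp measurable_snd)
  rw [lintegral_lintegral_swap hm.aemeasurable]
  refine lintegral_congr fun q => ?_
  rw [← lintegral_const_mul _ (hFu _), ← lintegral_mul_const _ ((hFu _).const_mul _)]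

/-- The form of an average is at most the supremum of the mixed forms times the square of the total
mass. -/
theorem kerForm_lintegral_le (h2 : ∀ i, H i < 1) {Z : Type*} [MeasurableSpace Z] (μ : Measure Z)
    [SFinite μ] {F : Z → Space k → ℝ≥0∞} (hF : Measurable (Function.uncurry F)) {C : ℝ≥0∞}
    (hC : ∀ z z', kerForm H (F z) (F z') ≤ C) :
    kerForm H (fun u => ∫⁻ z, F z u ∂μ) (fun u => ∫⁻ z, F z u ∂μ) ≤ C * μ univ * μ univ := by
  have hFz : ∀ z, Measurable (F z) := fun z => hF.comp (measurable_prodMk_left (x := z))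
  have hG : Measurable fun u => ∫⁻ z, F z u ∂μ := hF.lintegral_prod_left'
  rw [kerForm_lintegral_left μ hF hG]
  calc _ ≤ ∫⁻ _, C * μ univ ∂μ := by
        refine lintegral_mono fun z => ?_
        dsimp only
        rw [kerForm_comm h2 (hFz z) hG, kerForm_lintegral_left μ hF (hFz z)]
        refine (lintegral_mono fun z' => hC z' z).trans_eq ?_
        rw [lintegral_const]
    _ = _ := lintegral_const _

end FracPoisson

namespace FracPoisson

/-! ### Measurability of the exit point -/

variable {k : ℕ} {Ω : Type*} [MeasurableSpace Ω]

/-- A continuous path leaves `D` by time `a` if and only if the infimum of its distances to the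
complement of `D`, over a countable dense set of times stopped at `a`, is zero. -/
theorem measurableSet_exists_notMem {D : Set (Space k)} (hD : IsOpen D)
    {W : ℝ≥0 → Ω → Space k} (hm : ∀ t, Measurable (W t)) (hc : ∀ ω, Continuous fun t => W t ω)
    (x : Space k) (a : ℝ≥0) : MeasurableSet {ω | ∃ s ≤ a, x + W s ω ∉ D} := by
  set f : Ω → ℝ≥0 → ℝ≥0∞ := fun ω s => Metric.infEDist (x + W (min s a) ω) Dᶜ with hf
  have hfc : ∀ ω, Continuous (f ω) := fun ω =>
    Metric.continuous_infEDist.comp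
      (continuous_const.add ((hc ω).comp (continuous_id.min continuous_const)))
  have hmem : ∀ y, y ∉ D ↔ Metric.infEDist y Dᶜ = 0 := fun y =>
    Metric.mem_iff_infEDist_zero_of_closed hD.isClosed_compl
  have e : {ω | ∃ s ≤ a, x + W s ω ∉ D} =
      (fun ω => ⨅ n : ℕ, f ω (TopologicalSpace.denseSeq ℝ≥0 n)) ⁻¹' {0} := by
    ext ω
    simp only [mem_ofPred_eq, mem_preimage, mem_singleton_iff]
    constructor
    · rintro ⟨s, hs, hsD⟩
      have h : ∀ t, (⨅ n : ℕ, f ω (TopologicalSpace.denseSeq ℝ≥0 n)) ≤ f ω t := fun t =>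
        (TopologicalSpace.denseRange_denseSeq ℝ≥0).induction_on t
          (isClosed_le continuous_const (hfc ω)) fun n => iInf_le _ n
      have h0 : f ω s = 0 := by
        simp only [hf, min_eq_left hs]
        exact (hmem _).1 hsD
      exact le_antisymm (h0 ▸ h s) zero_le
    · intro h
      obtain ⟨s, hs, hmin⟩ := (isCompact_Icc (a := (0 : ℝ≥0)) (b := a)).exists_isMinOn
        ⟨0, by simp⟩ (hfc ω).continuousOn
      refine ⟨s, hs.2, (hmem _).2 (le_antisymm ?_ zero_le)⟩
      rw [← h]
      refine le_iInf fun n => ?_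
      have h1 := hmin (show min (TopologicalSpace.denseSeq ℝ≥0 n) a ∈ Icc 0 a by simp)
      have h2 : f ω s = Metric.infEDist (x + W s ω) Dᶜ := by
        simp only [hf, min_eq_left hs.2]
      have h3 : f ω (min (TopologicalSpace.denseSeq ℝ≥0 n) a) =
          f ω (TopologicalSpace.denseSeq ℝ≥0 n) := by
        simp only [hf, min_assoc, min_self]
      rw [← h2, ← h3]
      exact h1
  rw [e]
  refine (Measurable.iInf fun n => ?_) (measurableSet_singleton 0)
  exact Metric.continuous_infEDist.measurable.comp ((hm _).const_add x)

/-- The exit time exceeds `a` when the path leaves `D`, but not by time `a`. A path that never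
leaves has exit time `0` and is excluded by the first condition. -/
theorem measurable_exitTime {D : Set (Space k)} (hD : IsOpen D)
    {W : ℝ≥0 → Ω → Space k} (hm : ∀ t, Measurable (W t)) (hc : ∀ ω, Continuous fun t => W t ω)
    (x : Space k) : Measurable (exitTime D W x) := by
  refine measurable_of_Ioi fun a => ?_
  have e : exitTime D W x ⁻¹' Ioi a =
      (⋃ n : ℕ, {ω | ∃ s ≤ (n : ℝ≥0), x + W s ω ∉ D}) \ {ω | ∃ s ≤ a, x + W s ω ∉ D} := by
    ext ω
    simp only [mem_preimage, mem_Ioi, Set.mem_sdiff, mem_iUnion, mem_ofPred_eq]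
    set S : Set ℝ≥0 := {t | x + W t ω ∉ D} with hS
    have hcl : IsClosed S :=
      hD.isClosed_compl.preimage (continuous_const.add (hc ω))
    change a < sInf S ↔ _
    constructor
    · intro h
      have hne : S.Nonempty := by
        by_contra hne
        rw [not_nonempty_iff_eq_empty.1 hne] at h
        simp at h
      obtain ⟨t, ht⟩ := hne
      obtain ⟨n, hn⟩ := exists_nat_ge t
      refine ⟨⟨n, t, hn, ht⟩, ?_⟩
      rintro ⟨s, hs, hsD⟩
      exact absurd (csInf_le (OrderBot.bddBelow S) hsD) (not_le.2 (hs.trans_lt h))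
    · rintro ⟨⟨n, t, -, ht⟩, hno⟩
      by_contra h
      exact hno ⟨sInf S, not_lt.1 h, hcl.csInf_mem ⟨t, ht⟩ (OrderBot.bddBelow S)⟩
  rw [e]
  exact (MeasurableSet.iUnion fun n : ℕ => measurableSet_exists_notMem hD hm hc x (n : ℝ≥0)).diff
    (measurableSet_exists_notMem hD hm hc x a)

theorem measurable_exitPoint {D : Set (Space k)} (hD : IsOpen D)
    {W : ℝ≥0 → Ω → Space k} (hm : ∀ t, Measurable (W t)) (hc : ∀ ω, Continuous fun t => W t ω)
    (x : Space k) : Measurable (exitPoint D W x) := by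
  have h := measurable_uncurry_of_continuous_of_measurable (u := W) hc hm
  exact (h.comp ((measurable_exitTime hD hm hc x).prodMk measurable_id)).const_add x

/-- A process with almost surely continuous paths is indistinguishable from a measurable process all
of whose paths are continuous. -/
theorem exists_continuous_modification {P : Measure Ω} {W : ℝ≥0 → Ω → Space k}
    (hm : ∀ t, AEMeasurable (W t) P) (hc : ∀ᵐ ω ∂P, Continuous fun t => W t ω) :
    ∃ V : ℝ≥0 → Ω → Space k, (∀ t, Measurable (V t)) ∧ (∀ ω, Continuous fun t => V t ω) ∧
      ∀ᵐ ω ∂P, ∀ t, W t ω = V t ω := by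
  classical
  set d := TopologicalSpace.denseSeq ℝ≥0
  have hgood : ∀ᵐ ω ∂P, Continuous (fun t => W t ω) ∧ ∀ n, W (d n) ω = (hm (d n)).mk _ ω :=
    hc.and (ae_all_iff.2 fun n => (hm (d n)).ae_eq_mk)
  obtain ⟨N, hN, hNm, hN0⟩ := exists_measurable_superset_of_null (ae_iff.1 hgood)
  have hNc : ∀ ω, ω ∉ N → Continuous (fun t => W t ω) ∧ ∀ n, W (d n) ω = (hm (d n)).mk _ ω :=
    fun ω hω => by
      by_contra h
      exact hω (hN h)
  set V : ℝ≥0 → Ω → Space k := fun t => Nᶜ.indicator (W t) with hV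
  have hVc : ∀ ω, Continuous fun t => V t ω := by
    intro ω
    by_cases hω : ω ∈ N
    · simp only [hV, indicator_of_notMem (notMem_compl_iff.2 hω)]
      exact continuous_const
    · simp only [hV, indicator_of_mem (mem_compl hω)]
      exact (hNc ω hω).1
  have hVd : ∀ n, Measurable (V (d n)) := by
    intro n
    have e : V (d n) = Nᶜ.indicator ((hm (d n)).mk _) := by
      ext1 ω
      by_cases hω : ω ∈ N
      · simp only [hV, indicator_of_notMem (notMem_compl_iff.2 hω)]
      · simp only [hV, indicator_of_mem (mem_compl hω), (hNc ω hω).2]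
    rw [e]
    exact (hm (d n)).measurable_mk.indicator hNm.compl
  refine ⟨V, fun t => ?_, hVc, ?_⟩
  · obtain ⟨s, hs, hlim⟩ := mem_closure_iff_seq_limit.1
      ((TopologicalSpace.denseRange_denseSeq ℝ≥0) t)
    refine measurable_of_tendsto_metrizable (f := fun n => V (s n)) (fun n => ?_)
      (tendsto_pi_nhds.2 fun ω => ((hVc ω).tendsto t).comp hlim)
    obtain ⟨m, hm⟩ := hs n
    rw [← hm]
    exact hVd m
  · filter_upwards [compl_mem_ae_iff.2 hN0] with ω hω t
    simp only [hV, indicator_of_mem hω]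

/-- The paths of a Brownian motion are continuous only almost surely, so the exit point is only
almost everywhere measurable. -/
theorem aemeasurable_exitPoint {P : Measure Ω} {D : Set (Space k)} (hD : IsOpen D)
    {W : ℝ≥0 → Ω → Space k} (hm : ∀ t, AEMeasurable (W t) P)
    (hc : ∀ᵐ ω ∂P, Continuous fun t => W t ω) (x : Space k) :
    AEMeasurable (exitPoint D W x) P := by
  obtain ⟨V, hV, hVc, hWV⟩ := exists_continuous_modification hm hc
  refine ⟨_, measurable_exitPoint hD hV hVc x, ?_⟩
  filter_upwards [hWV] with ω hω
  simp only [exitPoint, exitTime, hω]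

theorem IsBrownianMotion.aemeasurable {P : Measure Ω} {W : ℝ≥0 → Ω → Space k}
    (hW : IsBrownianMotion W P) (t : ℝ≥0) : AEMeasurable (W t) P :=
  (WithLp.measurable_toLp 2 _).comp_aemeasurable
    (aemeasurable_pi_lambda _ fun i => (hW.isBrownianReal i).toIsPreBrownianReal.aemeasurable t)

theorem IsBrownianMotion.continuous {P : Measure Ω} {W : ℝ≥0 → Ω → Space k}
    (hW : IsBrownianMotion W P) : ∀ᵐ ω ∂P, Continuous fun t => W t ω := by
  have h : ∀ᵐ ω ∂P, ∀ i, Continuous fun t => W t ω i :=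
    ae_all_iff.2 fun i => (hW.isBrownianReal i).cont
  filter_upwards [h] with ω hω
  exact (PiLp.continuous_toLp 2 _).comp (continuous_pi hω)

theorem measurable_fundamentalSolution :
    Measurable (Function.uncurry (fundamentalSolution (k := k))) := by
  unfold Function.uncurry fundamentalSolution
  split_ifs <;> fun_prop

theorem measurable_fundamentalSolution_right (x : Space k) :
    Measurable fun y => fundamentalSolution x y :=
  measurable_fundamentalSolution.of_uncurry_left

theorem measurable_integral_fundamentalSolution {P : Measure Ω} [SFinite P] {Z : Ω → Space k}
    (hZ : AEMeasurable Z P) : Measurable fun y => ∫ ω, fundamentalSolution (Z ω) y ∂P := by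
  have e : ∀ y, ∫ ω, fundamentalSolution (Z ω) y ∂P =
      ∫ ω, fundamentalSolution (hZ.mk _ ω) y ∂P := fun y => by
    refine integral_congr_ae ?_
    filter_upwards [hZ.ae_eq_mk] with ω hω
    rw [hω]
  have hp : Measurable fun q : Space k × Ω => (hZ.mk _ q.2, q.1) :=
    (hZ.measurable_mk.comp measurable_snd).prodMk measurable_fst
  simp only [e]
  have hs := (measurable_fundamentalSolution.comp hp).stronglyMeasurable
  exact hs.integral_prod_right'.measurable

theorem measurable_greenSlice {P : Measure Ω} [SFinite P] {D : Set (Space k)} (hD : IsOpen D)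
    {W : ℝ≥0 → Ω → Space k} (hW : IsBrownianMotion W P) (x : Space k) :
    Measurable (greenSlice P W D x) := by
  have hZ := aemeasurable_exitPoint hD hW.aemeasurable hW.continuous x
  have h : Measurable (greenFunction P W D x) :=
    (measurable_fundamentalSolution_right x).sub (measurable_integral_fundamentalSolution hZ)
  exact h.indicator hD.measurableSet

end FracPoisson

namespace FracPoisson

/-! ### Domination of the Green function -/

variable {k : ℕ} {H : Fin k → ℝ}

/-- The product of the one-dimensional singularities `|z_i - y_i|^{-H_i θ}` on `[-R, R]^k`. -/
noncomputable def singProd (H : Fin k → ℝ) (θ R : ℝ) (z y : Space k) : ℝ≥0∞ :=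
  ∏ i, sing R (H i * θ) (z i) (y i)

theorem measurable_singProd (H : Fin k → ℝ) (θ R : ℝ) :
    Measurable (Function.uncurry (singProd H θ R)) := by
  unfold Function.uncurry singProd
  refine Finset.measurable_fun_prod _ fun i _ => ?_
  have h : Measurable fun q : Space k × Space k => (q.1 i, q.2 i) := by fun_prop
  exact (measurable_sing R (H i * θ)).comp h

/-- The constant `(k(2-k)ω_k)⁻¹` of the fundamental solution in dimension `k ≥ 3`. -/
noncomputable def fundamentalConst (k : ℕ) : ℝ :=
  1 / ((k : ℝ) * (2 - (k : ℝ)) * (volume (Metric.ball (0 : Space k) 1)).toReal)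

/-- Since `|z_i - y_i| ≤ |z - y|`, the singularity `|z-y|^{2-k}` is at most the product of the
singularities `|z_i-y_i|^{-H_i θ}`, as soon as `θ ∑ H_i = k - 2`. -/
theorem enorm_fundamentalSolution_le (hk : 3 ≤ k) (hH : ∀ i, 0 ≤ H i) {θ R : ℝ} (hθ : 0 ≤ θ)
    (hθk : θ * ∑ i, H i = k - 2) (z : Space k) {y : Space k} (hy : ∀ i, y i ∈ Icc (-R) R) :
    ‖fundamentalSolution z y‖ₑ ≤ ‖fundamentalConst k‖ₑ * singProd H θ R z y := by
  have hk' : (3 : ℝ) ≤ k := by exact_mod_cast hk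
  rw [fundamentalSolution, if_neg (by lia), enorm_mul]
  refine mul_le_mul' le_rfl ?_
  rcases eq_or_ne z y with rfl | hzy
  · -- at the pole, the left-hand side is `0 ^ (2 - k) = 0`
    rw [sub_self, norm_zero, Real.zero_rpow (by linarith), enorm_zero]
    exact zero_le
  have hpos : 0 < ‖z - y‖ := norm_pos_iff.2 (sub_ne_zero.2 hzy)
  have hexp : (2 : ℝ) - k = ∑ i, -(H i * θ) := by
    rw [Finset.sum_neg_distrib, ← Finset.sum_mul, mul_comm, hθk]; ring
  rw [Real.enorm_of_nonneg (by positivity), hexp, Real.rpow_sum_of_pos hpos,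
    ENNReal.ofReal_prod_of_nonneg fun i _ => by positivity, singProd]
  refine Finset.prod_le_prod' fun i _ => ?_
  rw [sing, indicator_of_mem (hy i), ← ENNReal.ofReal_rpow_of_pos hpos, ofReal_norm,
    ENNReal.rpow_neg, ENNReal.rpow_neg, ENNReal.inv_le_inv]
  refine ENNReal.rpow_le_rpow ?_ (mul_nonneg (hH i) hθ)
  rw [enorm_le_iff_norm_le]
  exact PiLp.norm_apply_le (z - y) i

/-- The sum of the Dirac measure at `x` and the law of `Z`, scaled by the constant of the
fundamental solution. For `Z` the exit point, the average of the singularities over this measure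
dominates the Green function with pole `x`. -/
noncomputable def poleMeasure {Ω : Type*} [MeasurableSpace Ω] (P : Measure Ω)
    (Z : Ω → Space k) (x : Space k) : Measure (Space k) :=
  ‖fundamentalConst k‖₊ • (Measure.dirac x + P.map Z)

theorem poleMeasure_univ {Ω : Type*} [MeasurableSpace Ω] {P : Measure Ω} [IsProbabilityMeasure P]
    {Z : Ω → Space k} (hZ : AEMeasurable Z P) (x : Space k) :
    poleMeasure P Z x univ = 2 * ‖fundamentalConst k‖ₑ := by
  have := Measure.isProbabilityMeasure_map hZ
  rw [poleMeasure, Measure.smul_apply, Measure.add_apply, measure_univ, measure_univ,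
    one_add_one_eq_two, ENNReal.smul_def, smul_eq_mul, mul_comm]
  rfl

instance {Ω : Type*} [MeasurableSpace Ω] (P : Measure Ω) [IsFiniteMeasure P]
    (Z : Ω → Space k) (x : Space k) : SFinite (poleMeasure P Z x) := by
  unfold poleMeasure; infer_instance

/-- The Green function is dominated by an average of products of one-dimensional singularities, with
poles at `x` and at the exit point. -/
theorem enorm_greenSlice_le (hk : 3 ≤ k) (hH : ∀ i, 0 ≤ H i) {θ R : ℝ} (hθ : 0 ≤ θ)
    (hθk : θ * ∑ i, H i = k - 2) {Ω : Type*} [MeasurableSpace Ω] {P : Measure Ω}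
    {W : ℝ≥0 → Ω → Space k} {D : Set (Space k)} (hD : ∀ y ∈ D, ∀ i, y i ∈ Icc (-R) R)
    (x : Space k) (hZ : AEMeasurable (exitPoint D W x) P) (y : Space k) :
    ‖greenSlice P W D x y‖ₑ ≤
      ∫⁻ z, singProd H θ R z y ∂(poleMeasure P (exitPoint D W x) x) := by
  by_cases hy : y ∈ D
  · have hm : Measurable fun z => singProd H θ R z y :=
      (measurable_singProd H θ R).of_uncurry_right
    have key := fun z => enorm_fundamentalSolution_le hk hH hθ hθk z (hD y hy)
    rw [poleMeasure, lintegral_smul_measure, lintegral_add_measure, lintegral_dirac' _ hm,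
      lintegral_map' hm.aemeasurable hZ, ENNReal.smul_def, smul_eq_mul, mul_add, greenSlice,
      indicator_of_mem hy, greenFunction]
    refine enorm_sub_le.trans (add_le_add (key x) ?_)
    refine (enorm_integral_le_lintegral_enorm _).trans ?_
    refine (lintegral_mono fun ω => key _).trans_eq ?_
    exact lintegral_const_mul' _ _ enorm_ne_top
  · rw [greenSlice, indicator_of_notMem hy, enorm_zero]
    exact zero_le

/-- In the `i`-th variable, the power `1 / H_i` of `|z_i - y_i|^{-H_i θ}` is the integrable
singularity `|z_i - y_i|^{-θ}`. -/
theorem mixedNorm_greenSlice_le (hk : 3 ≤ k) (hH : ∀ i, 0 < H i ∧ H i < 1) {θ R : ℝ}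
    (hθ : 0 ≤ θ) (hθk : θ * ∑ i, H i = k - 2) {Ω : Type*} [MeasurableSpace Ω] {P : Measure Ω}
    [IsProbabilityMeasure P] {W : ℝ≥0 → Ω → Space k} {D : Set (Space k)}
    (hD : ∀ y ∈ D, ∀ i, y i ∈ Icc (-R) R) (x : Space k)
    (hZ : AEMeasurable (exitPoint D W x) P) :
    mixedNorm (fun i => ENNReal.ofReal (1 / H i)) (greenSlice P W D x) ≤
      2 * ‖fundamentalConst k‖ₑ * ∏ i, singConst θ R ^ H i := by
  have hdom : mixedNorm (fun i => ENNReal.ofReal (1 / H i)) (greenSlice P W D x) ≤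
      iteratedNorm k (fun i => ENNReal.ofReal (1 / H i)) fun η =>
        ∫⁻ z, ∏ i, sing R (H i * θ) (z.ofLp i) (η i) ∂(poleMeasure P (exitPoint D W x) x) :=
    iteratedNorm_mono fun η =>
      enorm_greenSlice_le hk (fun i => (hH i).1.le) hθ hθk hD x hZ (WithLp.toLp 2 η)
  have hq : ∀ i, 1 < 1 / H i := fun i => by
    rw [lt_div_iff₀ (hH i).1, one_mul]; exact (hH i).2
  have hg : ∀ i, Measurable
      (Function.uncurry fun (z : Space k) t => sing R (H i * θ) (z.ofLp i) t) := fun i => by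
    have h : Measurable fun q : Space k × ℝ => (q.1 i, q.2) := by fun_prop
    exact (measurable_sing R (H i * θ)).comp h
  have hM : ∀ i (z : Space k), ∫⁻ t, sing R (H i * θ) (z.ofLp i) t ^ (1 / H i) ≤
      (singConst θ R ^ H i) ^ (1 / H i) := fun i z => by
    rw [← ENNReal.rpow_mul, mul_one_div_cancel (hH i).1.ne', ENNReal.rpow_one]
    exact lintegral_sing_rpow_le (hH i).1 hθ R _
  rw [← poleMeasure_univ hZ x]
  exact hdom.trans (iteratedNorm_lintegral_prod_le _ hq hg hM)

theorem exists_absNormSq_greenSlice_le (hk : 3 ≤ k) (hH : ∀ i, 1 / 2 ≤ H i ∧ H i < 1) {θ : ℝ}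
    (R : ℝ) (hθ : 0 ≤ θ) (hθ1 : θ < 1) (hθk : θ * ∑ i, H i = k - 2) :
    ∃ C : ℝ≥0∞, C < ∞ ∧ ∀ (Ω : Type*) [MeasurableSpace Ω] (P : Measure Ω)
      [IsProbabilityMeasure P] (W : ℝ≥0 → Ω → Space k) (D : Set (Space k)),
      (∀ y ∈ D, ∀ i, y i ∈ Icc (-R) R) → ∀ x, AEMeasurable (exitPoint D W x) P →
      absNormSq H (greenSlice P W D x) ≤ C := by
  choose c hc hcle using fun i => exists_kerForm1_sing_le (hH i).1 (hH i).2 hθ hθ1 R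
  refine ⟨(∏ i, c i) * (2 * ‖fundamentalConst k‖ₑ) * (2 * ‖fundamentalConst k‖ₑ), ?_, ?_⟩
  · have h2 : 2 * ‖fundamentalConst k‖ₑ < ∞ := ENNReal.mul_lt_top (by simp) enorm_lt_top
    exact ENNReal.mul_lt_top (ENNReal.mul_lt_top
      (ENNReal.prod_lt_top fun i _ => hc i) h2) h2
  intro Ω _ P _ W D hD x hZ
  rw [← poleMeasure_univ hZ x]
  have hle := enorm_greenSlice_le hk (fun i => by linarith [(hH i).1]) hθ hθk hD x hZ
  refine (kerForm_mono hle hle).trans ?_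
  refine kerForm_lintegral_le (fun i => (hH i).2) _ (measurable_singProd H θ R) fun z z' => ?_
  unfold singProd
  rw [kerForm_prod H (fun i => measurable_sing_right _ _ _) fun i => measurable_sing_right _ _ _]
  exact Finset.prod_le_prod' fun i _ => hcle i _ _

theorem exists_cube_of_isBounded {D : Set (Space k)} (hD : Bornology.IsBounded D) :
    ∃ R : ℝ, ∀ y ∈ D, ∀ i, y i ∈ Icc (-R) R := by
  obtain ⟨R, hR⟩ := hD.exists_norm_le
  refine ⟨R, fun y hy i => ?_⟩
  have := (PiLp.norm_apply_le y i).trans (hR y hy)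
  rwa [Real.norm_eq_abs, abs_le] at this

end FracPoisson

theorem lemmal3p2 (k : ℕ) (hk : 4 ≤ k) (H : Fin k → ℝ)
    (hH : ∀ i, 1 / 2 ≤ H i ∧ H i < 1) (hsum : (k : ℝ) - 2 < ∑ i, H i)
    (D : Set (FracPoisson.Space k)) (hD : FracPoisson.IsBoundedSmoothDomain D) :
    ∃ K K' : ℝ, 0 < K ∧ 0 < K' ∧
      ∀ (Ω₀ : Type*) [MeasurableSpace Ω₀] (P₀ : Measure Ω₀) [IsProbabilityMeasure P₀]
        (W : ℝ≥0 → Ω₀ → FracPoisson.Space k), FracPoisson.IsBrownianMotion W P₀ →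
        -- the mixed-norm bound for the Green function
        ((∀ x ∈ D, Measurable (FracPoisson.greenSlice P₀ W D x)) ∧
          (⨆ x ∈ D, FracPoisson.mixedNorm (fun i => ENNReal.ofReal (1 / H i))
            (FracPoisson.greenSlice P₀ W D x)) ≤ ENNReal.ofReal K) ∧
        -- the stochastic convolution against every fractional Brownian field is well defined
        ∀ (Ω : Type*) [MeasurableSpace Ω] (P : Measure Ω) [IsProbabilityMeasure P]
          (B : FracPoisson.Space k → Ω → ℝ), FracPoisson.IsFractionalBrownianField H B P →
          ∃ J : FracPoisson.Space k → Ω → ℝ, ∀ x ∈ D,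
            FracPoisson.IsFieldIntegral H B P (FracPoisson.greenSlice P₀ W D x) (J x) ∧
            (∀ Y : Ω → ℝ,
              FracPoisson.IsFieldIntegral H B P (FracPoisson.greenSlice P₀ W D x) Y →
                Y =ᵐ[P] J x) ∧
            ∫ ω, (J x ω) ^ 2 ∂P ≤ K' := by
  have hk3 : 3 ≤ k := by lia
  have hk4 : (4 : ℝ) ≤ k := by exact_mod_cast hk
  have h1 : ∀ i, 1 / 2 ≤ H i := fun i => (hH i).1
  have h2 : ∀ i, H i < 1 := fun i => (hH i).2
  have hS : 0 < ∑ i, H i := by linarith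
  -- the exponents `H_i θ` of the one-dimensional singularities add up to `k - 2`
  set θ : ℝ := ((k : ℝ) - 2) / ∑ i, H i with hθ
  have hθ0 : 0 ≤ θ := div_nonneg (by linarith) hS.le
  have hθ1 : θ < 1 := (div_lt_one hS).2 hsum
  have hθk : θ * ∑ i, H i = k - 2 := div_mul_cancel₀ _ hS.ne'
  obtain ⟨R, hR⟩ := FracPoisson.exists_cube_of_isBounded hD.isBounded
  obtain ⟨C, hC, hCle⟩ := FracPoisson.exists_absNormSq_greenSlice_le hk3 hH R hθ0 hθ1 hθk
  set M : ℝ≥0∞ := 2 * ‖FracPoisson.fundamentalConst k‖ₑ * ∏ i, FracPoisson.singConst θ R ^ H i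
  have hM : M ≠ ∞ := (ENNReal.mul_lt_top (ENNReal.mul_lt_top (by simp) enorm_lt_top)
    (ENNReal.prod_lt_top fun i _ => ENNReal.rpow_lt_top_of_nonneg (by linarith [h1 i])
      (FracPoisson.singConst_lt_top hθ1 R).ne)).ne
  refine ⟨M.toReal + 1, 2 * C.toReal + 1, by positivity, by positivity, ?_⟩
  intro Ω₀ _ P₀ _ W hW
  have hZ : ∀ x, AEMeasurable (FracPoisson.exitPoint D W x) P₀ :=
    FracPoisson.aemeasurable_exitPoint hD.isOpen hW.aemeasurable hW.continuous
  have hmeas := FracPoisson.measurable_greenSlice hD.isOpen hW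
  have habs := fun x => hCle Ω₀ P₀ W D hR x (hZ x)
  refine ⟨⟨fun x _ => hmeas x, iSup₂_le fun x _ => ?_⟩, ?_⟩
  · refine (FracPoisson.mixedNorm_greenSlice_le hk3 (fun i => ⟨by linarith [h1 i], h2 i⟩)
      hθ0 hθk hR x (hZ x)).trans ?_
    exact ENNReal.le_ofReal_iff_toReal_le hM (by positivity) |>.2 (by linarith)
  · intro Ω _ P _ B hB
    have hmem : ∀ x, FracPoisson.MemAbsH H (FracPoisson.greenSlice P₀ W D x) := fun x =>
      FracPoisson.memAbsH_iff.2 ⟨hmeas x, (habs x).trans_lt hC⟩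
    choose J hJ using fun x => FracPoisson.exists_isFieldIntegral h1 h2 hB (hmem x)
    refine ⟨J, fun x _ => ⟨hJ x, fun Y hY => hY.ae_eq h1 h2 hB (hJ x), ?_⟩⟩
    have hsq := (hJ x).integral_sq_le h1 h2 hB
    have hle := (FracPoisson.hNormSq_le_toReal (H := H) (FracPoisson.greenSlice P₀ W D x)).trans
      (ENNReal.toReal_mono hC.ne (habs x))
    linarith
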